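/- **Setting.** Let $n\ge 1$, $\gamma\in\mathbb C\setminus\{0\}$, $V=\mathbb C^n$ with matrix units $e_{ij}$, dynamical variables $\lambda=(\lambda_1,\dots,\lambda_n)\in\mathbb C^n$, $\lambda_{ij}=\lambda_i-\lambda_j$, $\sigma=\sum_k\lambda_k$, and spectral parameters $u,v,w\in\mathbb C$ attached to the tensor factors $1,2,3$. For a matrix function $M$ put $M_1=M\otimes 1$, $M_2=1\otimes M$; $M_{21}$ is $M_{12}$ with the two factors exchanged. Let $\lambda+\gamma h^j$ be $\lambda$ with $\lambda_j$ replaced by $\lambda_j+\gamma$, and $M_2(h_1)=\sum_j e_{jj}\otimes M(\lambda+\gamma h^j)$, $M_1(h_2)=\sum_j M(\lambda+\gamma h^j)\otimes e_{jj}$, $M_{12}(h_3)=\sum_j M(\lambda+\gamma h^j)\otimes e_{jj}$. Let $g=\exp(-\gamma\,\frac{d}{du})$, so that $g^t=\exp(t\log g)$ is the translation $u\mapsto u-t\gamma$; $M^g(u)=M(u-\gamma)$ and, for a function of two spectral parameters, $M^{gg}(u,v)=M(u-\gamma,v-\gamma)$. The rational non-constant ACF matrices are $$A_{12}(u,v;\lambda)=1+\sum_{i\ne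 j}x_{ij}(e_{ii}-e_{ij})\otimes(e_{jj}-e_{ji})+\tfrac{\gamma}{u-v}\,\mathsf d_{12}+\tfrac{\gamma}{v}\,\mathsf b_{12}-\tfrac{\gamma}{u+\gamma}\,\mathsf b_{21},$$ $$B_{12}(v;\lambda)=1+\sum_{i\ne j}y_{ij}\,e_{jj}\otimes(e_{ii}-e_{ij})-\tfrac{\gamma}{v+\gamma}\,\mathsf b_{12},\qquad C_{12}(u;\lambda)=B_{21}(u;\lambda),$$ $$D_{12}(u-v;\lambda)=1+\sum_{i\ne j}x_{ij}(e_{ij}\otimes e_{ji}-e_{ii}\otimes e_{jj})+\tfrac{\gamma}{u-v}\,\mathsf d_{12},$$ with $\mathsf d_{12}=\sum_{i,j}e_{ij}\otimes e_{ji}$, $\mathsf b_{12}=\sum_{i,j}e_{ii}\otimes e_{ji}$, $x_{ij}=\gamma/\lambda_{ij}$, $y_{ij}=\gamma/(\lambda_{ij}-\gamma)$. The twist $b=b(u;\lambda)$ is, for $1\le j\le n$, $$b_{ij}=\frac{\lambda_j^{\,i-1}}{\prod_{a\ne j}\lambda_{ja}}\quad(1\le i\le n-1),\qquad b_{nj}=\frac{\lambda_j^{\,n-1}(\sigma-\lambda_j+u+\gamma)}{(\sigma+u+f_0)\prod_{a\ne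 j}\lambda_{ja}},$$ where $f_0$ is a function of $\sigma+u$. For constant $f_0$, writing $U=\sigma+u+f_0$ and $W=\sigma+v+f_0$, put $$\begin{aligned}R(u,v;\lambda)={}&\Big(1+\tfrac{\gamma}{u-v}\Big)\Big[\sum_{i=1}^{n-1}e_{ii}\otimes e_{ii}+\tfrac{W(U-\gamma)}{U(W-\gamma)}\,e_{nn}\otimes e_{nn}\Big]+\sum_{\substack{i,j=1\\ i\ne j}}^{n-1}e_{ii}\otimes e_{jj}\\&+\tfrac{W}{W-\gamma}\sum_{i=1}^{n-1}e_{ii}\otimes e_{nn}+\tfrac{U-\gamma}{U}\sum_{i=1}^{n-1}e_{nn}\otimes e_{ii}\\&+\gamma\tfrac{\sigma+u+\gamma}{U}\sum_{k=1}^{n-1}\sum_{j=1}^{n-k}e_{n,n-k}\otimes e_{j,j+k-1}-\gamma\tfrac{\sigma+v}{W-\gamma}\sum_{k=1}^{n-1}\sum_{j=1}^{n-k}e_{j,j+k-1}\otimes e_{n,n-k}\\&+\gamma\sum_{i=1}^{n-1}\sum_{k=1}^{i-1}\sum_{j=1}^{i-k}\big(e_{i,i-k}\otimes e_{j,j+k-1}-e_{j,j+k-1}\otimes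 e_{i,i-k}\big)+\tfrac{\gamma}{u-v}\sum_{\substack{i,j=1\\ i\ne j}}^{n-1}e_{ij}\otimes e_{ji}\\&+\tfrac{\gamma}{u-v}\tfrac{U-\gamma}{W-\gamma}\sum_{i=1}^{n-1}e_{in}\otimes e_{ni}+\tfrac{\gamma}{u-v}\tfrac{W}{U}\sum_{i=1}^{n-1}e_{ni}\otimes e_{in}\\&-\tfrac{\gamma}{U}\sum_{i=1}^{n-1}\sum_{k=1}^{n-1-i}e_{n,n-i}\otimes e_{k,k+i}+\tfrac{\gamma}{W-\gamma}\sum_{i=1}^{n-1}\sum_{k=1}^{n-1-i}e_{k,k+i}\otimes e_{n,n-i}.\end{aligned}$$ Finally, put $$\begin{aligned}R^0(u,v)={}&\Big(1+\tfrac{\gamma}{u-v}\Big)\Big[\sum_{i=1}^{n-1}e_{ii}\otimes e_{ii}+\tfrac{u(v+\gamma)}{v(u+\gamma)}\,e_{nn}\otimes e_{nn}\Big]+\sum_{\substack{i,j=1\\ i\ne j}}^{n-1}e_{ii}\otimes e_{jj}\\&+\tfrac{v+\gamma}{v}\sum_{i=1}^{n-1}e_{ii}\otimes e_{nn}+\tfrac{u}{u+\gamma}\sum_{i=1}^{n-1}e_{nn}\otimes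 e_{ii}\\&+\gamma\sum_{i=1}^{n}\sum_{k=1}^{i-1}\sum_{j=1}^{i-k}\big(e_{i,i-k}\otimes e_{j,j+k-1}-e_{j,j+k-1}\otimes e_{i,i-k}\big)+\tfrac{\gamma}{u-v}\sum_{\substack{i,j=1\\ i\ne j}}^{n-1}e_{ij}\otimes e_{ji}\\&+\tfrac{\gamma}{u-v}\tfrac{u}{v}\sum_{i=1}^{n-1}e_{in}\otimes e_{ni}+\tfrac{\gamma}{u-v}\tfrac{v+\gamma}{u+\gamma}\sum_{i=1}^{n-1}e_{ni}\otimes e_{in}\\&-\tfrac{\gamma}{u+\gamma}\sum_{i=1}^{n-1}\sum_{k=1}^{n-1-i}e_{n,n-i}\otimes e_{k,k+i}+\tfrac{\gamma}{v}\sum_{i=1}^{n-1}\sum_{k=1}^{n-1-i}e_{k,k+i}\otimes e_{n,n-i}.\end{aligned}$$ **Claim.** 1. For every function $f_0$, $b(u;\lambda)$ is invertible whenever the $\lambda_i$ are pairwise distinct, $u+\gamma\ne0$ and $\sigma+u+f_0\ne0$. If moreover $\lambda_{ij}\ne\gamma$ for all $i\neq j$, then $B_{12}=b_2^{-1}\,b_2^{g}(h_1)$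 and $C_{12}=b_1^{-1}\,b_1^{g}(h_2)$. 2. For constant $f_0$, $$A_{12}=b_1^{-1}\,(b_2^{g})^{-1}\,R_{12}\,b_1^{g}\,b_2$$ whenever the $\lambda_i$ are pairwise distinct, $u\ne v$, $u+\gamma\neq0$, $v\ne0$, and $U,W,U-\gamma,W-\gamma$ are nonzero. 3. For constant $f_0$, $$D_{12}=(b_1^{g})^{-1}(h_2)\,(b_2^{g})^{-1}\,R_{12}\,b_1^{g}\,b_2^{g}(h_1)$$ whenever $\lambda_{ij}\notin\{0,\gamma\}$ for all $i\ne j$, $u\neq v$, $u\ne0$, $v\ne0$, and $U,W,U-\gamma,W-\gamma$ are nonzero. 4. For constant $f_0$, $R$ is quasi non-dynamical: $R_{12}=R_{12}^{gg}(h_3)$ whenever $u\neq v$ and $U$, $W-\gamma$ are nonzero. 5. For $f_0=\gamma$, $R$ is de-dynamized to $R^0$: $$R_{12}=e^{-\frac{\sigma}{\gamma}(\log g_1+\log g_2)}\,R^0_{12}\,e^{\frac{\sigma}{\gamma}(\log g_1+\log g_2)},$$ that is, $R(u,v;\lambda)=R^0(u+\sigma,v+\sigma)$, whenever $u\ne v$,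 $\sigma+u+\gamma\neq0$ and $\sigma+v\ne0$. 6. $R^0$ depends on $u$ and $v$ separately: there is no function $F$ with $R^0(u,v)=F(u-v)$ for all $u,v$ with $u\ne v$, $u+\gamma\ne0$, $v\ne0$. 7. $R^0$ solves the $g$-deformed Yang–Baxter equation $$R^0_{12}\,R^0_{13}{}^{gg}\,R^0_{23}=R^0_{23}{}^{gg}\,R^0_{13}\,R^0_{12}{}^{gg}$$ for all pairwise distinct $u,v,w$ with $u\notin\{0,-\gamma\}$, $v\notin\{0,\gamma,-\gamma\}$, $w\notin\{0,\gamma\}$. -/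

import Mathlib

open scoped Kronecker

noncomputable section

namespace ACF

/-- Operators on `V`, `V ⊗ V`, `V ⊗ V ⊗ V`, where `V = ℂⁿ`, as matrices in the standard basis. -/
abbrev Mat (n : ℕ) := Matrix (Fin n) (Fin n) ℂ
abbrev Mat2 (n : ℕ) := Matrix (Fin n × Fin n) (Fin n × Fin n) ℂ
abbrev Mat3 (n : ℕ) := Matrix (Fin n × Fin n × Fin n) (Fin n × Fin n × Fin n) ℂ

/-- The elementary matrix `e_{ij}`, indices in `Fin n`. -/
def e {n : ℕ} (i j : Fin n) : Mat n := Matrix.single i j 1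

/-- The elementary matrix `e_{ij}` with natural-number indices `1 ≤ i, j ≤ n`. -/
def E (n i j : ℕ) : Mat n :=
  Matrix.of fun a b => if (a : ℕ) + 1 = i ∧ (b : ℕ) + 1 = j then 1 else 0

/-! ### Spaces, spectral shift, dynamical shift -/

/-- `M₁ = M ⊗ 1`. -/
def sp1 {n : ℕ} (M : Mat n) : Mat2 n := M ⊗ₖ (1 : Mat n)

/-- `M₂ = 1 ⊗ M`. -/
def sp2 {n : ℕ} (M : Mat n) : Mat2 n := (1 : Mat n) ⊗ₖ M

/-- `M₂₁`: exchange of the two tensor factors. -/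
def flip {n : ℕ} (M : Mat2 n) : Mat2 n := M.submatrix Prod.swap Prod.swap

/-- `M₁₂` on the triple tensor product. -/
def leg12 {n : ℕ} (M : Mat2 n) : Mat3 n :=
  Matrix.of fun p q => if p.2.2 = q.2.2 then M (p.1, p.2.1) (q.1, q.2.1) else 0

/-- `M₁₃` on the triple tensor product. -/
def leg13 {n : ℕ} (M : Mat2 n) : Mat3 n :=
  Matrix.of fun p q => if p.2.1 = q.2.1 then M (p.1, p.2.2) (q.1, q.2.2) else 0

/-- `M₂₃` on the triple tensor product. -/
def leg23 {n : ℕ} (M : Mat2 n) : Mat3 n :=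
  Matrix.of fun p q => if p.1 = q.1 then M (p.2.1, p.2.2) (q.2.1, q.2.2) else 0

/-- Conjugation `g^t M g^{-t}` of a function of the spectral parameter, where
`g = exp(-γ d/du)`, so that `g^t = exp(t log g) = exp(-t γ d/du)` is the translation
`u ↦ u - t γ`.  In particular `M^g = gConj γ 1 M`. -/
def gConj {X : Type*} (γ t : ℂ) (M : ℂ → X) : ℂ → X := fun u => M (u - t * γ)

/-- Conjugation `(g₁ g₂)^t M (g₁ g₂)^{-t}` of a function of two spectral parameters;
`M^{gg} = gConj2 γ 1 M`. -/
def gConj2 {X : Type*} (γ t : ℂ) (M : ℂ → ℂ → X) : ℂ → ℂ → X :=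
  fun u v => M (u - t * γ) (v - t * γ)

/-- `λ + γ h` on the `j`-th weight space: `λ_j` is replaced by `λ_j + γ`. -/
def shift {n : ℕ} (γ : ℂ) (j : Fin n) (lam : Fin n → ℂ) : Fin n → ℂ := lam + Pi.single j γ

/-- `M₂(h₁) = ∑_j e_{jj} ⊗ M(λ + γ h^j)`. -/
def dyn2h1 {n : ℕ} (γ : ℂ) (M : (Fin n → ℂ) → Mat n) (lam : Fin n → ℂ) : Mat2 n :=
  ∑ j : Fin n, e j j ⊗ₖ M (shift γ j lam)

/-- `M₁(h₂) = ∑_j M(λ + γ h^j) ⊗ e_{jj}`. -/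
def dyn1h2 {n : ℕ} (γ : ℂ) (M : (Fin n → ℂ) → Mat n) (lam : Fin n → ℂ) : Mat2 n :=
  ∑ j : Fin n, M (shift γ j lam) ⊗ₖ e j j

/-- `M₁₂(h₃) = ∑_j M(λ + γ h^j) ⊗ e_{jj}` on the triple tensor product. -/
def dyn12h3 {n : ℕ} (γ : ℂ) (M : (Fin n → ℂ) → Mat2 n) (lam : Fin n → ℂ) : Mat3 n :=
  Matrix.of fun p q =>
    if p.2.2 = q.2.2 then M (shift γ p.2.2 lam) (p.1, p.2.1) (q.1, q.2.1) else 0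

/-! ### The rational non-constant Arutyunov-Chekhov-Frolov structure matrices -/

def x {n : ℕ} (γ : ℂ) (lam : Fin n → ℂ) (i j : Fin n) : ℂ := γ / (lam i - lam j)

def y {n : ℕ} (γ : ℂ) (lam : Fin n → ℂ) (i j : Fin n) : ℂ := γ / (lam i - lam j - γ)

/-- `d₁₂ = ∑ e_{ij} ⊗ e_{ji}`, the permutation matrix. -/
def dMat (n : ℕ) : Mat2 n := ∑ i : Fin n, ∑ j : Fin n, e i j ⊗ₖ e j i

/-- `b₁₂ = ∑ e_{ii} ⊗ e_{ji}`. -/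
def bMat (n : ℕ) : Mat2 n := ∑ i : Fin n, ∑ j : Fin n, e i i ⊗ₖ e j i

def Ainf {n : ℕ} (γ : ℂ) (lam : Fin n → ℂ) : Mat2 n :=
  1 + ∑ i : Fin n, ∑ j ∈ Finset.univ.erase i,
    x γ lam i j • ((e i i - e i j) ⊗ₖ (e j j - e j i))

def Binf {n : ℕ} (γ : ℂ) (lam : Fin n → ℂ) : Mat2 n :=
  1 + ∑ i : Fin n, ∑ j ∈ Finset.univ.erase i,
    y γ lam i j • (e j j ⊗ₖ (e i i - e i j))

def Dinf {n : ℕ} (γ : ℂ) (lam : Fin n → ℂ) : Mat2 n :=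
  1 + ∑ i : Fin n, ∑ j ∈ Finset.univ.erase i,
    x γ lam i j • (e i j ⊗ₖ e j i - e i i ⊗ₖ e j j)

def A {n : ℕ} (γ u v : ℂ) (lam : Fin n → ℂ) : Mat2 n :=
  Ainf γ lam + (γ / (u - v)) • dMat n + (γ / v) • bMat n - (γ / (u + γ)) • flip (bMat n)

def B {n : ℕ} (γ v : ℂ) (lam : Fin n → ℂ) : Mat2 n :=
  Binf γ lam - (γ / (v + γ)) • bMat n

/-- `C₁₂(u; λ) = B₂₁(u; λ)`. -/
def C {n : ℕ} (γ u : ℂ) (lam : Fin n → ℂ) : Mat2 n := flip (B γ u lam)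

/-- `D₁₂(s; λ)`, where `s` is the difference of the spectral parameters. -/
def D {n : ℕ} (γ s : ℂ) (lam : Fin n → ℂ) : Mat2 n :=
  Dinf γ lam + (γ / s) • dMat n

/-! ### The twist and the `R`-matrices -/

/-- `σ = ∑ λ_k`. -/
def sigma {n : ℕ} (lam : Fin n → ℂ) : ℂ := ∑ k : Fin n, lam k

/-- The twist `b(u; λ)`; `f₀` is a function of `σ + u`.  Row `i : Fin n` is row number `i + 1`. -/
def twist {n : ℕ} (γ : ℂ) (f0 : ℂ → ℂ) (u : ℂ) (lam : Fin n → ℂ) : Mat n :=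
  Matrix.of fun i j =>
    if (i : ℕ) + 1 = n then
      lam j ^ (i : ℕ) * (sigma lam - lam j + u + γ) /
        ((∏ a ∈ Finset.univ.erase j, (lam j - lam a)) *
          (sigma lam + u + f0 (sigma lam + u)))
    else
      lam j ^ (i : ℕ) / ∏ a ∈ Finset.univ.erase j, (lam j - lam a)

/-- The quasi non-dynamical matrix `R(u, v; λ)`, with constant `f₀`. -/
def R {n : ℕ} (γ f0 u v : ℂ) (lam : Fin n → ℂ) : Mat2 n :=
  let σ := sigma lam
  (1 + γ / (u - v)) • ∑ i ∈ Finset.Icc 1 (n - 1), E n i i ⊗ₖ E n i i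
  + ((1 + γ / (u - v)) * ((σ + v + f0) * (σ + u - γ + f0)
      / ((σ + u + f0) * (σ + v - γ + f0)))) • (E n n n ⊗ₖ E n n n)
  + ∑ i ∈ Finset.Icc 1 (n - 1), ∑ j ∈ (Finset.Icc 1 (n - 1)).erase i, E n i i ⊗ₖ E n j j
  + ((σ + v + f0) / (σ + v - γ + f0)) •
      ∑ i ∈ Finset.Icc 1 (n - 1), E n i i ⊗ₖ E n n n
  + ((σ + u - γ + f0) / (σ + u + f0)) •
      ∑ i ∈ Finset.Icc 1 (n - 1), E n n n ⊗ₖ E n i i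
  + (γ * ((σ + u + γ) / (σ + u + f0))) •
      ∑ k ∈ Finset.Icc 1 (n - 1), ∑ j ∈ Finset.Icc 1 (n - k),
        E n n (n - k) ⊗ₖ E n j (j + k - 1)
  - (γ * ((σ + v) / (σ + v - γ + f0))) •
      ∑ k ∈ Finset.Icc 1 (n - 1), ∑ j ∈ Finset.Icc 1 (n - k),
        E n j (j + k - 1) ⊗ₖ E n n (n - k)
  + γ • ∑ i ∈ Finset.Icc 1 (n - 1), ∑ k ∈ Finset.Icc 1 (i - 1), ∑ j ∈ Finset.Icc 1 (i - k),
      (E n i (i - k) ⊗ₖ E n j (j + k - 1) - E n j (j + k - 1) ⊗ₖ E n i (i - k))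
  + (γ / (u - v)) •
      ∑ i ∈ Finset.Icc 1 (n - 1), ∑ j ∈ (Finset.Icc 1 (n - 1)).erase i, E n i j ⊗ₖ E n j i
  + (γ / (u - v) * ((σ + u - γ + f0) / (σ + v - γ + f0))) •
      ∑ i ∈ Finset.Icc 1 (n - 1), E n i n ⊗ₖ E n n i
  + (γ / (u - v) * ((σ + v + f0) / (σ + u + f0))) •
      ∑ i ∈ Finset.Icc 1 (n - 1), E n n i ⊗ₖ E n i n
  - (γ / (σ + u + f0)) •
      ∑ i ∈ Finset.Icc 1 (n - 1), ∑ k ∈ Finset.Icc 1 (n - 1 - i),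
        E n n (n - i) ⊗ₖ E n k (k + i)
  + (γ / (σ + v - γ + f0)) •
      ∑ i ∈ Finset.Icc 1 (n - 1), ∑ k ∈ Finset.Icc 1 (n - 1 - i),
        E n k (k + i) ⊗ₖ E n n (n - i)

/-- The non-dynamical matrix `R⁰(u, v)`. -/
def R0 (n : ℕ) (γ u v : ℂ) : Mat2 n :=
  (1 + γ / (u - v)) • ∑ i ∈ Finset.Icc 1 (n - 1), E n i i ⊗ₖ E n i i
  + ((1 + γ / (u - v)) * (u * (v + γ) / (v * (u + γ)))) • (E n n n ⊗ₖ E n n n)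
  + ∑ i ∈ Finset.Icc 1 (n - 1), ∑ j ∈ (Finset.Icc 1 (n - 1)).erase i, E n i i ⊗ₖ E n j j
  + ((v + γ) / v) • ∑ i ∈ Finset.Icc 1 (n - 1), E n i i ⊗ₖ E n n n
  + (u / (u + γ)) • ∑ i ∈ Finset.Icc 1 (n - 1), E n n n ⊗ₖ E n i i
  + γ • ∑ i ∈ Finset.Icc 1 n, ∑ k ∈ Finset.Icc 1 (i - 1), ∑ j ∈ Finset.Icc 1 (i - k),
      (E n i (i - k) ⊗ₖ E n j (j + k - 1) - E n j (j + k - 1) ⊗ₖ E n i (i - k))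
  + (γ / (u - v)) •
      ∑ i ∈ Finset.Icc 1 (n - 1), ∑ j ∈ (Finset.Icc 1 (n - 1)).erase i, E n i j ⊗ₖ E n j i
  + (γ / (u - v) * (u / v)) • ∑ i ∈ Finset.Icc 1 (n - 1), E n i n ⊗ₖ E n n i
  + (γ / (u - v) * ((v + γ) / (u + γ))) • ∑ i ∈ Finset.Icc 1 (n - 1), E n n i ⊗ₖ E n i n
  - (γ / (u + γ)) •
      ∑ i ∈ Finset.Icc 1 (n - 1), ∑ k ∈ Finset.Icc 1 (n - 1 - i),
        E n n (n - i) ⊗ₖ E n k (k + i)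
  + (γ / v) •
      ∑ i ∈ Finset.Icc 1 (n - 1), ∑ k ∈ Finset.Icc 1 (n - 1 - i),
        E n k (k + i) ⊗ₖ E n n (n - i)

/-- Points where `λ_i ≠ λ_j` and `λ_i - λ_j ≠ γ` for all `i ≠ j`. -/
def Generic {n : ℕ} (γ : ℂ) (lam : Fin n → ℂ) : Prop :=
  ∀ i j : Fin n, i ≠ j → lam i - lam j ≠ 0 ∧ lam i - lam j ≠ γ

end ACF

end

noncomputable section

namespace ACF

/-! ### Entries of the `R`-matrix -/

/-! Up to the diagonal factor `gauge` on rows, column `j` of the twist is the Lagrange weight `wt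
lam j` times the polynomial vector f_p(X) = (1, X, …, X^(n-2), X^(n-1)(p - X)) (`polyVec`) at X =
λ_j, with p = σ+u+γ. Everything thus becomes a statement about polynomials evaluated at the nodes
λ_j. The gauge also absorbs f₀: by `R_apply` it turns R into `Rpoly`, which involves only γ, s =
γ/(u-v), p = σ+u+γ and q = σ+v.

The heart is `sum_Rpoly_mul`: `Rpoly` sends f_{p-γ}(X) ⊗ f_{q+γ}(Y) to f_p(X) ⊗ f_q(Y) + s f_p(Y) ⊗
f_q(X) plus γ times the divided difference of f_p(X) ⊗ f_q(Y) under X ↔ Y. It moves the parameters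
p, q by ±γ and, for X ≠ Y, combines the identity and the exchange of nodes with coefficients 1 +
γ/(X-Y) and s - γ/(X-Y).

At X = λ_i, Y = λ_j with i ≠ j these are the coefficients in A. For i = j the divided difference is
confluent; summing it over all nodes (`sum_wt_mul_polyDiv`) trades it for the sums over the other
nodes present in A, and the leftover last-row terms are matched by the terms in γ/v and γ/(u+γ),
because ∑ wt_j f_p(λ_j) is p - σ in the last row and 0 elsewhere. For D the second node set is
shifted, so i = j means Y = X + γ and the identity coefficient vanishes. B needs no R, only
interpolation at the extra point λ_a + γ.

R sees λ only through σ, in the combinations σ+u, σ+v and u-v, whence the two claims on the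
dynamical variable. For Yang–Baxter, the g-shifts are exactly those that make the parameters p, q of
consecutive factors match; on f(X) ⊗ f(Y) ⊗ f(Z) the equation reduces to rational identities in X,
Y, Z, and such vectors with distinct X, Y, Z separate operators (`Mat3_ext`). -/

theorem E_apply (n i j : ℕ) (a b : Fin n) :
    E n i j a b = if (a : ℕ) + 1 = i ∧ (b : ℕ) + 1 = j then 1 else 0 := rfl

theorem E_kronecker_apply (n i j k l : ℕ) (a b c d : Fin n) :
    (E n i j ⊗ₖ E n k l) (a, b) (c, d) =
      if (a : ℕ) + 1 = i ∧ (c : ℕ) + 1 = j ∧ (b : ℕ) + 1 = k ∧ (d : ℕ) + 1 = l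
        then 1 else 0 := by
  simp only [Matrix.kroneckerMap_apply, E_apply, ← ite_and, mul_ite, mul_one, mul_zero]
  exact if_congr (by tauto) rfl rfl

theorem sum_indicator {ι : Type*} (s : Finset ι) (i₀ : ι) (P : ι → Prop) [DecidablePred P]
    {Q : Prop} [Decidable Q] (h : ∀ i ∈ s, P i → i = i₀ ∧ Q) (h' : Q → i₀ ∈ s ∧ P i₀) :
    ∑ i ∈ s, (if P i then (1 : ℂ) else 0) = if Q then 1 else 0 := by
  split_ifs with hQ
  · rw [Finset.sum_eq_single_of_mem i₀ (h' hQ).1 fun i hi hne => if_neg fun hP =>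
      hne (h i hi hP).1, if_pos (h' hQ).2]
  · exact Finset.sum_eq_zero fun i hi => if_neg fun hP => hQ (h i hi hP).2

/-- The indicator of the support of `∑_{k,j} e_{a,a-k} ⊗ e_{j,j+k-1}`. -/
def cg (a b c d : ℕ) : ℂ := if b ≤ c ∧ c < a ∧ c + d + 1 = a + b then 1 else 0

section entries

variable {n : ℕ} (a b c d : Fin n)

theorem sum_diag_apply :
    (∑ i ∈ Finset.Icc 1 (n - 1), E n i i ⊗ₖ E n i i) (a, b) (c, d) =
      if (a : ℕ) + 1 < n ∧ a = b ∧ a = c ∧ a = d then 1 else 0 := by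
  have ha := a.isLt; have hb := b.isLt; have hc := c.isLt; have hd := d.isLt
  simp only [Matrix.sum_apply, E_kronecker_apply, Fin.ext_iff]
  apply sum_indicator _ (a + 1 : ℕ) <;> intros <;>
    simp only [Finset.mem_Icc, true_and] at * <;> omega

theorem sum_offdiag_apply :
    (∑ i ∈ Finset.Icc 1 (n - 1), ∑ j ∈ (Finset.Icc 1 (n - 1)).erase i,
      E n i i ⊗ₖ E n j j) (a, b) (c, d) =
      if (a : ℕ) + 1 < n ∧ (b : ℕ) + 1 < n ∧ a ≠ b ∧ a = c ∧ b = d then 1 else 0 := by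
  have ha := a.isLt; have hb := b.isLt; have hc := c.isLt; have hd := d.isLt
  simp only [Matrix.sum_apply, E_kronecker_apply, Fin.ext_iff, ne_eq]
  rw [Finset.sum_sigma']
  apply sum_indicator _ ⟨(a + 1 : ℕ), (b + 1 : ℕ)⟩
  · rintro ⟨i, j⟩ h1 h2
    simp only [Finset.mem_sigma, Finset.mem_erase, Finset.mem_Icc, Sigma.mk.injEq,
      heq_eq_eq] at *
    omega
  · intro h
    simp only [Finset.mem_sigma, Finset.mem_erase, Finset.mem_Icc, true_and] at *
    omega

theorem sum_perm_apply :
    (∑ i ∈ Finset.Icc 1 (n - 1), ∑ j ∈ (Finset.Icc 1 (n - 1)).erase i,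
      E n i j ⊗ₖ E n j i) (a, b) (c, d) =
      if (a : ℕ) + 1 < n ∧ (b : ℕ) + 1 < n ∧ a ≠ b ∧ a = d ∧ b = c then 1 else 0 := by
  have ha := a.isLt; have hb := b.isLt; have hc := c.isLt; have hd := d.isLt
  simp only [Matrix.sum_apply, E_kronecker_apply, Fin.ext_iff, ne_eq]
  rw [Finset.sum_sigma']
  apply sum_indicator _ ⟨(a + 1 : ℕ), (b + 1 : ℕ)⟩
  · rintro ⟨i, j⟩ h1 h2
    simp only [Finset.mem_sigma, Finset.mem_erase, Finset.mem_Icc, Sigma.mk.injEq,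
      heq_eq_eq] at *
    omega
  · intro h
    simp only [Finset.mem_sigma, Finset.mem_erase, Finset.mem_Icc, true_and] at *
    omega

theorem sum_in_last_apply :
    (∑ i ∈ Finset.Icc 1 (n - 1), E n i i ⊗ₖ E n n n) (a, b) (c, d) =
      if (a : ℕ) + 1 < n ∧ a = c ∧ (b : ℕ) + 1 = n ∧ (d : ℕ) + 1 = n then 1 else 0 := by
  have ha := a.isLt; have hb := b.isLt; have hc := c.isLt; have hd := d.isLt
  simp only [Matrix.sum_apply, E_kronecker_apply, Fin.ext_iff]
  apply sum_indicator _ (a + 1 : ℕ) <;> intros <;>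
    simp only [Finset.mem_Icc, true_and] at * <;> omega

theorem sum_last_in_apply :
    (∑ i ∈ Finset.Icc 1 (n - 1), E n n n ⊗ₖ E n i i) (a, b) (c, d) =
      if (b : ℕ) + 1 < n ∧ b = d ∧ (a : ℕ) + 1 = n ∧ (c : ℕ) + 1 = n then 1 else 0 := by
  have ha := a.isLt; have hb := b.isLt; have hc := c.isLt; have hd := d.isLt
  simp only [Matrix.sum_apply, E_kronecker_apply, Fin.ext_iff]
  apply sum_indicator _ (b + 1 : ℕ) <;> intros <;>
    simp only [Finset.mem_Icc, true_and] at * <;> omega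

theorem sum_swap_last_apply :
    (∑ i ∈ Finset.Icc 1 (n - 1), E n i n ⊗ₖ E n n i) (a, b) (c, d) =
      if (a : ℕ) + 1 < n ∧ a = d ∧ (b : ℕ) + 1 = n ∧ (c : ℕ) + 1 = n then 1 else 0 := by
  have ha := a.isLt; have hb := b.isLt; have hc := c.isLt; have hd := d.isLt
  simp only [Matrix.sum_apply, E_kronecker_apply, Fin.ext_iff]
  apply sum_indicator _ (a + 1 : ℕ) <;> intros <;>
    simp only [Finset.mem_Icc, true_and] at * <;> omega

theorem sum_last_swap_apply :
    (∑ i ∈ Finset.Icc 1 (n - 1), E n n i ⊗ₖ E n i n) (a, b) (c, d) =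
      if (b : ℕ) + 1 < n ∧ b = c ∧ (a : ℕ) + 1 = n ∧ (d : ℕ) + 1 = n then 1 else 0 := by
  have ha := a.isLt; have hb := b.isLt; have hc := c.isLt; have hd := d.isLt
  simp only [Matrix.sum_apply, E_kronecker_apply, Fin.ext_iff]
  apply sum_indicator _ (b + 1 : ℕ) <;> intros <;>
    simp only [Finset.mem_Icc, true_and] at * <;> omega

theorem sum_last_row_left_apply :
    (∑ k ∈ Finset.Icc 1 (n - 1), ∑ j ∈ Finset.Icc 1 (n - k),
        E n n (n - k) ⊗ₖ E n j (j + k - 1)) (a, b) (c, d) =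
      if (a : ℕ) + 1 = n then cg a b c d else 0 := by
  have ha := a.isLt; have hb := b.isLt; have hc := c.isLt; have hd := d.isLt
  simp only [Matrix.sum_apply, E_kronecker_apply, cg, ← ite_and]
  rw [Finset.sum_sigma']
  apply sum_indicator _ ⟨(n - 1 - c : ℕ), (b + 1 : ℕ)⟩
  · rintro ⟨i, j⟩ h1 h2
    simp only [Finset.mem_sigma, Finset.mem_Icc, Sigma.mk.injEq, heq_eq_eq] at *
    omega
  · intro h
    simp only [Finset.mem_sigma, Finset.mem_Icc, true_and] at *
    omega

theorem sum_last_row_right_apply :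
    (∑ k ∈ Finset.Icc 1 (n - 1), ∑ j ∈ Finset.Icc 1 (n - k),
        E n j (j + k - 1) ⊗ₖ E n n (n - k)) (a, b) (c, d) =
      if (b : ℕ) + 1 = n then cg b a d c else 0 := by
  have ha := a.isLt; have hb := b.isLt; have hc := c.isLt; have hd := d.isLt
  simp only [Matrix.sum_apply, E_kronecker_apply, cg, ← ite_and]
  rw [Finset.sum_sigma']
  apply sum_indicator _ ⟨(n - 1 - d : ℕ), (a + 1 : ℕ)⟩
  · rintro ⟨i, j⟩ h1 h2
    simp only [Finset.mem_sigma, Finset.mem_Icc, Sigma.mk.injEq, heq_eq_eq] at *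
    omega
  · intro h
    simp only [Finset.mem_sigma, Finset.mem_Icc, true_and] at *
    omega

theorem sum_last_row_left_succ_apply :
    (∑ i ∈ Finset.Icc 1 (n - 1), ∑ k ∈ Finset.Icc 1 (n - 1 - i),
        E n n (n - i) ⊗ₖ E n k (k + i)) (a, b) (c, d) =
      if (a : ℕ) + 1 = n then cg a (b + 1) c d else 0 := by
  have ha := a.isLt; have hb := b.isLt; have hc := c.isLt; have hd := d.isLt
  simp only [Matrix.sum_apply, E_kronecker_apply, cg, ← ite_and]
  rw [Finset.sum_sigma']
  apply sum_indicator _ ⟨(n - 1 - c : ℕ), (b + 1 : ℕ)⟩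
  · rintro ⟨i, j⟩ h1 h2
    simp only [Finset.mem_sigma, Finset.mem_Icc, Sigma.mk.injEq, heq_eq_eq] at *
    omega
  · intro h
    simp only [Finset.mem_sigma, Finset.mem_Icc, true_and] at *
    omega

theorem sum_last_row_right_succ_apply :
    (∑ i ∈ Finset.Icc 1 (n - 1), ∑ k ∈ Finset.Icc 1 (n - 1 - i),
        E n k (k + i) ⊗ₖ E n n (n - i)) (a, b) (c, d) =
      if (b : ℕ) + 1 = n then cg b (a + 1) d c else 0 := by
  have ha := a.isLt; have hb := b.isLt; have hc := c.isLt; have hd := d.isLt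
  simp only [Matrix.sum_apply, E_kronecker_apply, cg, ← ite_and]
  rw [Finset.sum_sigma']
  apply sum_indicator _ ⟨(n - 1 - d : ℕ), (a + 1 : ℕ)⟩
  · rintro ⟨i, j⟩ h1 h2
    simp only [Finset.mem_sigma, Finset.mem_Icc, Sigma.mk.injEq, heq_eq_eq] at *
    omega
  · intro h
    simp only [Finset.mem_sigma, Finset.mem_Icc, true_and] at *
    omega

theorem sum_bulk_apply :
    (∑ i ∈ Finset.Icc 1 (n - 1), ∑ k ∈ Finset.Icc 1 (i - 1), ∑ j ∈ Finset.Icc 1 (i - k),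
      (E n i (i - k) ⊗ₖ E n j (j + k - 1) - E n j (j + k - 1) ⊗ₖ E n i (i - k)))
        (a, b) (c, d) =
      (if (a : ℕ) + 1 < n then cg a b c d else 0) -
        if (b : ℕ) + 1 < n then cg b a d c else 0 := by
  have ha := a.isLt; have hb := b.isLt; have hc := c.isLt; have hd := d.isLt
  simp only [Matrix.sum_apply, Matrix.sub_apply, E_kronecker_apply, cg, ← ite_and,
    Finset.sum_sub_distrib]
  simp only [Finset.sum_sigma']
  congr 1
  · apply sum_indicator _ ⟨(a + 1 : ℕ), (a - c : ℕ), (b + 1 : ℕ)⟩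
    · rintro ⟨i, j, k⟩ h1 h2
      simp only [Finset.mem_sigma, Finset.mem_Icc, Sigma.mk.injEq, heq_eq_eq] at *
      omega
    · intro h
      simp only [Finset.mem_sigma, Finset.mem_Icc, true_and] at *
      omega
  · apply sum_indicator _ ⟨(b + 1 : ℕ), (b - d : ℕ), (a + 1 : ℕ)⟩
    · rintro ⟨i, j, k⟩ h1 h2
      simp only [Finset.mem_sigma, Finset.mem_Icc, Sigma.mk.injEq, heq_eq_eq] at *
      omega
    · intro h
      simp only [Finset.mem_sigma, Finset.mem_Icc, true_and] at *
      omega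

end entries

/-- The diagonal gauge factor `diag(1, …, 1, U)`. -/
def gauge {n : ℕ} (U : ℂ) (a : Fin n) : ℂ := if (a : ℕ) + 1 = n then U else 1

/-- The `R`-matrix in the polynomial gauge, with `p = σ + u + γ`, `q = σ + v`,
`s = γ / (u - v)`. -/
def Rpoly (n : ℕ) (γ s p q : ℂ) : Mat2 n := Matrix.of fun ab cd =>
  (if ab.1 = cd.1 ∧ ab.2 = cd.2 then 1 else 0)
  + (if ab.1 = cd.2 ∧ ab.2 = cd.1 then s else 0)
  + γ * (if (ab.1 : ℕ) + 1 = n then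
      if (ab.2 : ℕ) + 1 = n then 0
      else p * cg ab.1 ab.2 cd.1 cd.2 - cg ab.1 (ab.2 + 1) cd.1 cd.2
    else
      if (ab.2 : ℕ) + 1 = n then
        cg ab.2 (ab.1 + 1) cd.2 cd.1 - q * cg ab.2 ab.1 cd.2 cd.1
      else cg ab.1 ab.2 cd.1 cd.2 - cg ab.2 ab.1 cd.2 cd.1)

/-- The support of `cg` has both column indices strictly below a, hence never on the last basis
vector, where `gauge` and `polyVec` are exceptional. -/
theorem cg_eq_zero_left {n : ℕ} {a b c d : ℕ} (ha : a < n) (hc : c + 1 = n) :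
    cg a b c d = 0 := if_neg (by omega)

theorem cg_eq_zero_right {n : ℕ} {a b c d : ℕ} (ha : a < n) (hc : d + 1 = n) :
    cg a b c d = 0 := if_neg (by omega)

/-- The rows carry the gauge of (U, W-γ) and the columns that of (U-γ, W), the factors occurring in
the twists on the two sides of R. All dependence on f₀ sits in these factors. -/
theorem R_apply {n : ℕ} (γ f0 u v : ℂ) (lam : Fin n → ℂ)
    (hU : sigma lam + u + f0 ≠ 0) (hW : sigma lam + v - γ + f0 ≠ 0) (a b c d : Fin n) :
    R γ f0 u v lam (a, b) (c, d) * (gauge (sigma lam + u + f0) a *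
        gauge (sigma lam + v - γ + f0) b) =
      Rpoly n γ (γ / (u - v)) (sigma lam + u + γ) (sigma lam + v) (a, b) (c, d) *
        (gauge (sigma lam + u - γ + f0) c * gauge (sigma lam + v + f0) d) := by
  have hUγ : sigma lam + u - γ + f0 = sigma lam + u + f0 - γ := by ring
  have hWγ : sigma lam + v + f0 = sigma lam + v - γ + f0 + γ := by ring
  simp only [R, Rpoly, Matrix.add_apply, Matrix.sub_apply, Matrix.smul_apply, smul_eq_mul,
    sum_diag_apply, sum_offdiag_apply, sum_perm_apply, sum_in_last_apply, sum_last_in_apply,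
    sum_swap_last_apply, sum_last_swap_apply, sum_last_row_left_apply,
    sum_last_row_right_apply, sum_last_row_left_succ_apply, sum_last_row_right_succ_apply,
    sum_bulk_apply, E_kronecker_apply, Matrix.of_apply, gauge]
  rw [hUγ, hWγ]
  generalize sigma lam + u + f0 = U at *
  generalize sigma lam + v - γ + f0 = W at *
  obtain _ | m := n
  · exact a.elim0
  have hl (x : Fin m) : (x : ℕ) ≠ m := x.isLt.ne
  have hl' (x : Fin m) : Fin.last m ≠ x.castSucc := (Fin.castSucc_ne_last x).symm
  have c1 (x y : ℕ) (z : Fin m) : cg z x y m = 0 :=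
    cg_eq_zero_right (z.isLt.trans m.lt_succ_self) rfl
  have c2 (x y : ℕ) (z : Fin m) : cg z x m y = 0 :=
    cg_eq_zero_left (z.isLt.trans m.lt_succ_self) rfl
  have c3 (x y : ℕ) : cg m x y m = 0 := cg_eq_zero_right m.lt_succ_self rfl
  have c4 (x y : ℕ) : cg m x m y = 0 := cg_eq_zero_left m.lt_succ_self rfl
  have c5 (x y : ℕ) (z : Fin m) : cg z m x y = 0 := if_neg (by have := z.isLt; omega)
  have c6 (x y : ℕ) : cg m m x y = 0 := if_neg (by omega)
  have c7 (x y : ℕ) : cg m (m + 1) x y = 0 := if_neg (by omega)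
  -- Whether each index is last or not decides which sums contribute. When some index is last the
  -- gauge factors make the entries rational identities; when none is, only the supports of the
  -- indicators have to be compared.
  induction a using Fin.lastCases <;> induction b using Fin.lastCases <;>
    induction c using Fin.lastCases <;> induction d using Fin.lastCases
  all_goals
    simp only [Fin.val_last, Fin.val_castSucc, Fin.castSucc_inj, Fin.castSucc_ne_last, hl, hl',
      add_left_inj, if_true, if_false, Fin.is_lt, add_lt_add_iff_right, lt_irrefl, true_and,
      and_true, false_and, and_false, mul_zero, mul_one, add_zero, zero_add, sub_zero, c1, c2,
      c3, c4, c5, c6, c7, ne_eq, zero_mul, zero_sub, sub_self]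
  · field_simp
  iterate 6
    · (try split_ifs) <;> field_simp <;> ring_nf
  · split_ifs <;> first
      | ring1
      | (exfalso; grind)

/-! ### Divided differences of monomials -/

/-- `(X^a Y^b - X^b Y^a) / (X - Y)` for `b ≤ a`, and `0` for `a ≤ b`. -/
def geomDiv (a b : ℕ) (X Y : ℂ) : ℂ :=
  X ^ b * Y ^ b * ∑ i ∈ Finset.range (a - b), X ^ i * Y ^ (a - b - 1 - i)

theorem geomDiv_comm (a b : ℕ) (X Y : ℂ) : geomDiv a b X Y = geomDiv a b Y X := by
  rw [geomDiv, geomDiv, mul_comm (X ^ b), ← Finset.sum_range_reflect]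
  congr 1
  refine Finset.sum_congr rfl fun i hi => ?_
  rw [Finset.mem_range] at hi
  rw [mul_comm, show a - b - 1 - (a - b - 1 - i) = i by omega]

theorem geomDiv_of_le {a b : ℕ} (h : a ≤ b) (X Y : ℂ) : geomDiv a b X Y = 0 := by
  simp [geomDiv, Nat.sub_eq_zero_of_le h]

theorem sub_mul_geomDiv {a b : ℕ} (h : b ≤ a) (X Y : ℂ) :
    (X - Y) * geomDiv a b X Y = X ^ a * Y ^ b - X ^ b * Y ^ a := by
  obtain ⟨k, rfl⟩ := Nat.exists_eq_add_of_le h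
  have := (Commute.all X Y).geom_sum₂_mul k
  simp only [geomDiv, Nat.add_sub_cancel_left]
  linear_combination X ^ b * Y ^ b * this

/-- The two end terms of the geometric sum are split off. They account for the difference between
the index b + 1 in the last row of `Rpoly` and the divided difference of a polynomial of degree one
higher. -/
theorem geomDiv_succ {a b : ℕ} (h : b < a) (X Y : ℂ) :
    geomDiv (a + 1) b X Y = geomDiv a (b + 1) X Y + X ^ a * Y ^ b + X ^ b * Y ^ a := by
  obtain ⟨k, rfl⟩ := Nat.exists_eq_add_of_lt h
  simp only [geomDiv, show b + k + 1 + 1 - b = k + 1 + 1 by omega,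
    show b + k + 1 - (b + 1) = k by omega]
  rw [Finset.sum_range_succ, Finset.sum_range_succ']
  have : ∑ i ∈ Finset.range k, X ^ (i + 1) * Y ^ (k + 1 + 1 - 1 - (i + 1)) =
      X * Y * ∑ i ∈ Finset.range k, X ^ i * Y ^ (k - 1 - i) := by
    rw [Finset.mul_sum]
    refine Finset.sum_congr rfl fun i hi => ?_
    rw [Finset.mem_range] at hi
    rw [show k + 1 + 1 - 1 - (i + 1) = k - 1 - i + 1 by omega]
    ring
  rw [this]
  simp
  ring

theorem geomDiv_succ_self (a : ℕ) (X Y : ℂ) : geomDiv (a + 1) a X Y = X ^ a * Y ^ a := by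
  simp [geomDiv]

/-! ### Action of the `R`-matrix on pairs of polynomials -/

/-- The vector `(1, X, …, X^{n-2}, X^{n-1} (p - X))`. -/
def polyVec {n : ℕ} (p X : ℂ) (a : Fin n) : ℂ :=
  if (a : ℕ) + 1 = n then X ^ (a : ℕ) * (p - X) else X ^ (a : ℕ)

/-- On the support c runs over [b, a) and d = a + b - 1 - c, so only monomial components of the
vectors occur and the parameters p, q play no role. -/
theorem sum_cg_mul {n : ℕ} {a : ℕ} (ha : a < n) (b : ℕ) (p q X Y : ℂ) :
    ∑ c : Fin n, ∑ d : Fin n, cg a b c d * (polyVec p X c * polyVec q Y d) =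
      geomDiv a b X Y := by
  have h1 (c : Fin n) : ∑ d : Fin n, cg a b c d * (polyVec p X c * polyVec q Y d) =
      if b ≤ c ∧ (c : ℕ) < a then X ^ (c : ℕ) * Y ^ (a + b - 1 - c) else 0 := by
    split_ifs with h
    · rw [Finset.sum_eq_single (⟨a + b - 1 - c, by omega⟩ : Fin n)]
      · rw [cg, if_pos (by simp only; omega), polyVec, polyVec, if_neg (by omega),
          if_neg (by simp only; omega), one_mul]
      · intro d _ hd
        rw [cg, if_neg, zero_mul]
        rw [ne_eq, Fin.ext_iff] at hd
        simp only at hd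
        omega
      · simp
    · exact Finset.sum_eq_zero fun d _ => by rw [cg, if_neg (by omega), zero_mul]
  simp_rw [h1]
  rw [Fin.sum_univ_eq_sum_range
    (fun c => if b ≤ c ∧ c < a then X ^ c * Y ^ (a + b - 1 - c) else 0), ← Finset.sum_filter]
  have h2 : (Finset.range n).filter (fun c => b ≤ c ∧ c < a) = Finset.Ico b a := by
    ext c
    simp only [Finset.mem_filter, Finset.mem_range, Finset.mem_Ico]
    omega
  rw [h2, Finset.sum_Ico_eq_sum_range, geomDiv, Finset.mul_sum]
  refine Finset.sum_congr rfl fun i hi => ?_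
  rw [Finset.mem_range] at hi
  rw [show a + b - 1 - (b + i) = b + (a - b - 1 - i) by omega, pow_add, pow_add]
  ring

theorem sum_cg_mul_swap {n : ℕ} {a : ℕ} (ha : a < n) (b : ℕ) (p q X Y : ℂ) :
    ∑ c : Fin n, ∑ d : Fin n, cg a b d c * (polyVec p X c * polyVec q Y d) =
      geomDiv a b X Y := by
  rw [Finset.sum_comm, geomDiv_comm, ← sum_cg_mul ha b q p]
  simp_rw [mul_comm (polyVec q Y _)]

/-- The divided difference `(f_p(X)_a f_q(Y)_b - f_p(Y)_a f_q(X)_b) / (X - Y)`, where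
`f_p = polyVec p`. -/
def polyDiv {n : ℕ} (p q X Y : ℂ) (a b : Fin n) : ℂ :=
  if (a : ℕ) + 1 = n then
    if (b : ℕ) + 1 = n then (p - q) * geomDiv (a + 1) b X Y
    else p * geomDiv a b X Y - geomDiv (a + 1) b X Y
  else
    if (b : ℕ) + 1 = n then geomDiv (b + 1) a X Y - q * geomDiv b a X Y
    else geomDiv a b X Y - geomDiv b a X Y

theorem sub_mul_polyDiv {n : ℕ} (p q X Y : ℂ) (a b : Fin n) :
    (X - Y) * polyDiv p q X Y a b =
      polyVec p X a * polyVec q Y b - polyVec p Y a * polyVec q X b := by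
  have ha := a.isLt
  have hb := b.isLt
  unfold polyDiv polyVec
  split_ifs with h1 h2 h2
  · obtain rfl : a = b := Fin.ext (by omega)
    rw [geomDiv_succ_self]
    ring
  · linear_combination p * sub_mul_geomDiv (show (b : ℕ) ≤ a by omega) X Y -
      sub_mul_geomDiv (show (b : ℕ) ≤ a + 1 by omega) X Y
  · linear_combination sub_mul_geomDiv (show (a : ℕ) ≤ b + 1 by omega) X Y -
      q * sub_mul_geomDiv (show (a : ℕ) ≤ b by omega) X Y
  · rcases le_total (a : ℕ) b with h | h
    · rw [geomDiv_of_le h]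
      linear_combination - sub_mul_geomDiv h X Y
    · rw [geomDiv_of_le h]
      linear_combination sub_mul_geomDiv h X Y

theorem polyDiv_eq {n : ℕ} (p q : ℂ) {X Y : ℂ} (h : X ≠ Y) (a b : Fin n) :
    polyDiv p q X Y a b =
      (polyVec p X a * polyVec q Y b - polyVec p Y a * polyVec q X b) / (X - Y) := by
  rw [eq_div_iff (sub_ne_zero.2 h), mul_comm, sub_mul_polyDiv]

/-- Replacing p - γ, q + γ by p, q in the identity and exchange terms costs monomials that
`geomDiv_succ` restores; this works precisely because s(p - q - γ) = γ, that is, s = γ/(u-v). No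
division by X - Y occurs, so X = Y is allowed. -/
theorem sum_Rpoly_mul {n : ℕ} (γ s p q : ℂ) (hs : s * (p - q - γ) = γ) (X Y : ℂ)
    (a b : Fin n) :
    ∑ c : Fin n, ∑ d : Fin n, Rpoly n γ s p q (a, b) (c, d) *
        (polyVec (p - γ) X c * polyVec (q + γ) Y d) =
      polyVec p X a * polyVec q Y b + s * (polyVec p Y a * polyVec q X b) +
        γ * polyDiv p q X Y a b := by
  have ha := a.isLt
  have hb := b.isLt
  have h1 : ∑ c : Fin n, ∑ d : Fin n, (if a = c ∧ b = d then (1 : ℂ) else 0) *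
      (polyVec (p - γ) X c * polyVec (q + γ) Y d) =
        polyVec (p - γ) X a * polyVec (q + γ) Y b := by
    simp [ite_and]
  have h2 : ∑ c : Fin n, ∑ d : Fin n, (if a = d ∧ b = c then s else 0) *
      (polyVec (p - γ) X c * polyVec (q + γ) Y d) =
        s * (polyVec (p - γ) X b * polyVec (q + γ) Y a) := by
    simp_rw [and_comm (a := a = _)]
    simp [ite_and]
  simp only [Rpoly, Matrix.of_apply, add_mul, Finset.sum_add_distrib, h1, h2, mul_assoc,
    ← Finset.mul_sum]
  simp only [polyDiv]
  split_ifs with ha' hb' hb'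
  · obtain rfl : a = b := Fin.ext (by omega)
    simp only [polyVec, if_pos ha', geomDiv_succ_self, zero_mul, Finset.sum_const_zero]
    linear_combination (X ^ (a : ℕ) * Y ^ (a : ℕ) * (γ - Y + X)) * hs
  · simp only [sub_mul, mul_assoc, Finset.sum_sub_distrib, ← Finset.mul_sum, sum_cg_mul ha]
    rw [geomDiv_succ (by omega)]
    simp only [polyVec, if_pos ha', if_neg hb']
    linear_combination - X ^ (b : ℕ) * Y ^ (a : ℕ) * hs
  · simp only [sub_mul, mul_assoc, Finset.sum_sub_distrib, ← Finset.mul_sum,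
      sum_cg_mul_swap hb]
    rw [geomDiv_succ (by omega)]
    simp only [polyVec, if_pos hb', if_neg ha']
    linear_combination X ^ (b : ℕ) * Y ^ (a : ℕ) * hs
  · simp only [sub_mul, Finset.sum_sub_distrib, sum_cg_mul_swap hb, sum_cg_mul ha]
    simp only [polyVec, if_neg hb', if_neg ha']
    ring

theorem sum_Rpoly_mul_of_ne {n : ℕ} (γ s p q : ℂ) (hs : s * (p - q - γ) = γ) {X Y : ℂ}
    (h : X ≠ Y) (a b : Fin n) :
    ∑ c : Fin n, ∑ d : Fin n, Rpoly n γ s p q (a, b) (c, d) *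
        (polyVec (p - γ) X c * polyVec (q + γ) Y d) =
      (1 + γ / (X - Y)) * (polyVec p X a * polyVec q Y b) +
        (s - γ / (X - Y)) * (polyVec p Y a * polyVec q X b) := by
  rw [sum_Rpoly_mul γ s p q hs, polyDiv_eq p q h]
  ring

/-! ### Lagrange interpolation sums -/

section lagrange

variable {n : ℕ} {lam : Fin n → ℂ}

/-- The Lagrange weight `1 / ∏_{a ≠ j} (λ_j - λ_a)`. -/
def wt (lam : Fin n → ℂ) (j : Fin n) : ℂ := (∏ a ∈ Finset.univ.erase j, (lam j - lam a))⁻¹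

theorem wt_ne_zero (h : Function.Injective lam) (j : Fin n) : wt lam j ≠ 0 :=
  inv_ne_zero <| Finset.prod_ne_zero_iff.2 fun _ ha =>
    sub_ne_zero.2 <| h.ne (Finset.ne_of_mem_erase ha).symm

theorem sum_wt_mul_eval (h : Function.Injective lam) {P : Polynomial ℂ} (hP : P.degree < n) :
    ∑ j, wt lam j * P.eval (lam j) = P.coeff (n - 1) := by
  have := Lagrange.coeff_eq_sum (s := Finset.univ) (v := lam) h.injOn (P := P) (by simpa using hP)
  rw [Finset.card_univ, Fintype.card_fin] at this
  rw [this]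
  exact Finset.sum_congr rfl fun j _ => by rw [wt, div_eq_inv_mul]

theorem prod_mul_sum_wt_mul_eval_div (h : Function.Injective lam) {P : Polynomial ℂ}
    (hP : P.degree < n) {z : ℂ} (hz : ∀ j, z ≠ lam j) :
    (∏ a, (z - lam a)) * ∑ j, wt lam j * P.eval (lam j) / (z - lam j) = P.eval z := by
  have h1 := Lagrange.eq_interpolate (s := Finset.univ) (v := lam) h.injOn (f := P)
    (by simpa using hP)
  conv_rhs => rw [h1]
  rw [Lagrange.eval_interpolate_not_at_node _ fun j _ => hz j, Lagrange.eval_nodal]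
  congr 1
  refine Finset.sum_congr rfl fun j _ => ?_
  rw [wt, Lagrange.nodalWeight, Finset.prod_inv_distrib]
  ring

/-- `X^n` reduced modulo `∏ (X - λ_a)`. -/
def powRem (lam : Fin n → ℂ) : Polynomial ℂ := Polynomial.X ^ n - Lagrange.nodal Finset.univ lam

theorem degree_powRem (lam : Fin n → ℂ) : (powRem lam).degree < n := by
  have h1 : (Polynomial.X ^ n : Polynomial ℂ).degree = n := Polynomial.degree_X_pow n
  have h2 : (Lagrange.nodal Finset.univ lam).degree = n := by simp [Lagrange.degree_nodal]
  have := Polynomial.degree_sub_lt_left (h1.trans h2.symm) (pow_ne_zero _ Polynomial.X_ne_zero)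
    (by rw [(Polynomial.monic_X_pow n).leadingCoeff, Lagrange.nodal_monic.leadingCoeff])
  rwa [h1] at this

theorem eval_powRem (lam : Fin n → ℂ) (z : ℂ) :
    (powRem lam).eval z = z ^ n - ∏ a, (z - lam a) := by
  simp [powRem, Lagrange.eval_nodal]

theorem eval_powRem_node (lam : Fin n → ℂ) (j : Fin n) : (powRem lam).eval (lam j) = lam j ^ n := by
  rw [eval_powRem, Finset.prod_eq_zero (Finset.mem_univ j) (sub_self _), sub_zero]

/-- Vieta: the subleading coefficient of the nodal polynomial is -σ. This is how σ enters the
interpolation sums. -/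
theorem coeff_powRem (hn : 1 ≤ n) (lam : Fin n → ℂ) : (powRem lam).coeff (n - 1) = sigma lam := by
  have := Polynomial.prod_X_sub_C_coeff_card_pred Finset.univ lam
    (by simpa using (show 0 < n from hn))
  rw [Finset.card_univ, Fintype.card_fin] at this
  rw [powRem, Polynomial.coeff_sub, Lagrange.nodal_eq, this, Polynomial.coeff_X_pow,
    if_neg (by omega), sigma]
  ring

theorem sum_wt_mul_pow (h : Function.Injective lam) {i : ℕ} (hi : i < n) :
    ∑ j, wt lam j * lam j ^ i = if i + 1 = n then 1 else 0 := by
  have := sum_wt_mul_eval h (P := Polynomial.X ^ i)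
    (by rw [Polynomial.degree_X_pow]; exact_mod_cast hi)
  simp only [Polynomial.eval_pow, Polynomial.eval_X, Polynomial.coeff_X_pow] at this
  rw [this]
  exact if_congr (by omega) rfl rfl

theorem sum_wt_mul_pow_card (hn : 1 ≤ n) (h : Function.Injective lam) :
    ∑ j, wt lam j * lam j ^ n = sigma lam := by
  simpa only [eval_powRem_node, coeff_powRem hn] using sum_wt_mul_eval h (degree_powRem lam)

theorem sum_wt_mul_polyVec (h : Function.Injective lam) (p : ℂ) (a : Fin n) :
    ∑ j, wt lam j * polyVec p (lam j) a = if (a : ℕ) + 1 = n then p - sigma lam else 0 := by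
  have ha := a.isLt
  simp only [polyVec]
  split_ifs with h1
  · have h2 := sum_wt_mul_pow h ha
    have h3 := sum_wt_mul_pow_card (by omega) h
    rw [if_pos h1] at h2
    rw [← h3]
    trans p * ∑ j, wt lam j * lam j ^ (a : ℕ) - ∑ j, wt lam j * lam j ^ n
    swap
    · rw [h2, mul_one]
    rw [Finset.mul_sum, ← Finset.sum_sub_distrib]
    refine Finset.sum_congr rfl fun j _ => ?_
    rw [show lam j ^ n = lam j ^ (a : ℕ) * lam j by rw [← pow_succ, h1]]
    ring
  · rw [sum_wt_mul_pow h ha, if_neg h1]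

/-- Interpolation is exact in degree below n. The last component has degree n, so X^n is replaced by
its remainder `powRem`, which produces the correction ∏(z - λ_a). -/
theorem prod_mul_sum_wt_mul_polyVec_div (h : Function.Injective lam) (p : ℂ) {z : ℂ}
    (hz : ∀ j, z ≠ lam j) (a : Fin n) :
    (∏ a, (z - lam a)) * ∑ j, wt lam j * polyVec p (lam j) a / (z - lam j) =
      polyVec p z a + if (a : ℕ) + 1 = n then ∏ a, (z - lam a) else 0 := by
  have ha := a.isLt
  have h2 := prod_mul_sum_wt_mul_eval_div h (P := Polynomial.X ^ (a : ℕ))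
    (by rw [Polynomial.degree_X_pow]; exact_mod_cast ha) hz
  simp only [Polynomial.eval_pow, Polynomial.eval_X] at h2
  simp only [polyVec]
  split_ifs with h1
  · have h3 := prod_mul_sum_wt_mul_eval_div h (degree_powRem lam) hz
    simp only [eval_powRem_node, eval_powRem] at h3
    have h4 : ∑ j, wt lam j * (lam j ^ (a : ℕ) * (p - lam j)) / (z - lam j) =
        p * ∑ j, wt lam j * lam j ^ (a : ℕ) / (z - lam j) -
          ∑ j, wt lam j * lam j ^ n / (z - lam j) := by
      rw [Finset.mul_sum, ← Finset.sum_sub_distrib]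
      refine Finset.sum_congr rfl fun j _ => ?_
      rw [show lam j ^ n = lam j ^ (a : ℕ) * lam j by rw [← pow_succ, h1]]
      ring
    rw [h4, mul_sub, h3, show z ^ n = z ^ (a : ℕ) * z by rw [← pow_succ, h1]]
    linear_combination p * h2
  · rw [h2, add_zero]

/-- The weighted sum extracts the coefficient of Y^(n-1). The exponents of Y are at most a - 1, so
only the term i = 0 can contribute, and only when a = n. -/
theorem sum_wt_mul_geomDiv (h : Function.Injective lam) {a : ℕ} (ha : a ≤ n) (b : ℕ) (X : ℂ) :
    ∑ j, wt lam j * geomDiv a b X (lam j) = if a = n ∧ b < n then X ^ b else 0 := by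
  have h1 : ∑ j, wt lam j * geomDiv a b X (lam j) =
      ∑ i ∈ Finset.range (a - b), X ^ (b + i) * ∑ j, wt lam j * lam j ^ (a - 1 - i) := by
    simp_rw [Finset.mul_sum]
    rw [Finset.sum_comm]
    refine Finset.sum_congr rfl fun j _ => ?_
    rw [geomDiv, Finset.mul_sum, Finset.mul_sum]
    refine Finset.sum_congr rfl fun i hi => ?_
    rw [Finset.mem_range] at hi
    rw [show a - 1 - i = b + (a - b - 1 - i) by omega, pow_add, pow_add]
    ring
  rw [h1]
  split_ifs with h2
  · rw [Finset.sum_eq_single 0]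
    · rw [sum_wt_mul_pow h (by omega), if_pos (by omega), mul_one, add_zero]
    · intro i hi hi0
      rw [Finset.mem_range] at hi
      rw [sum_wt_mul_pow h (by omega), if_neg (by omega), mul_zero]
    · intro h3
      rw [Finset.mem_range] at h3
      omega
  · refine Finset.sum_eq_zero fun i hi => ?_
    rw [Finset.mem_range] at hi
    rw [sum_wt_mul_pow h (by omega), if_neg (by omega), mul_zero]

theorem sum_wt_mul_polyDiv (h : Function.Injective lam) (p q X : ℂ) (a b : Fin n) :
    ∑ j, wt lam j * polyDiv p q X (lam j) a b =
      (if (b : ℕ) + 1 = n then polyVec p X a else 0) -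
        if (a : ℕ) + 1 = n then polyVec q X b else 0 := by
  have ha := a.isLt
  have hb := b.isLt
  simp only [polyDiv, polyVec]
  split_ifs with h1 h2 h2
  · obtain rfl : a = b := Fin.ext (by omega)
    simp_rw [mul_left_comm (wt lam _) (p - q)]
    rw [← Finset.mul_sum, sum_wt_mul_geomDiv h h1.le, if_pos (by omega)]
    ring
  · simp_rw [mul_sub, mul_left_comm (wt lam _) p]
    rw [Finset.sum_sub_distrib, ← Finset.mul_sum, sum_wt_mul_geomDiv h h1.le, if_pos (by omega),
      sum_wt_mul_geomDiv h ha.le, if_neg (by omega)]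
    ring
  · simp_rw [mul_sub, mul_left_comm (wt lam _) q]
    rw [Finset.sum_sub_distrib, ← Finset.mul_sum, sum_wt_mul_geomDiv h h2.le, if_pos (by omega),
      sum_wt_mul_geomDiv h hb.le, if_neg (by omega)]
    ring
  · simp_rw [mul_sub]
    rw [Finset.sum_sub_distrib, sum_wt_mul_geomDiv h ha.le, if_neg (by omega),
      sum_wt_mul_geomDiv h hb.le, if_neg (by omega)]

end lagrange

/-! ### The twist -/

theorem gauge_ne_zero {n : ℕ} {U : ℂ} (hU : U ≠ 0) (a : Fin n) : gauge U a ≠ 0 := by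
  unfold gauge
  split_ifs
  exacts [hU, one_ne_zero]

theorem twist_apply {n : ℕ} (γ : ℂ) (f0 : ℂ → ℂ) (u : ℂ) (lam : Fin n → ℂ) (i j : Fin n) :
    twist γ f0 u lam i j = polyVec (sigma lam + u + γ) (lam j) i * wt lam j /
      gauge (sigma lam + u + f0 (sigma lam + u)) i := by
  simp only [twist, Matrix.of_apply, polyVec, wt, gauge]
  split_ifs
  · rw [div_mul_eq_div_div, div_eq_mul_inv (_ * _)]
    ring
  · rw [div_one, div_eq_mul_inv]

/-- A row vector killed by the twist gives a combination of the components of f_p vanishing at every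
node. Its weighted sum is (p - σ) = u + γ times the last coefficient, which is therefore zero; the
rest is a Vandermonde system. -/
theorem isUnit_twist {n : ℕ} (γ : ℂ) (f0 : ℂ → ℂ) (u : ℂ) (lam : Fin n → ℂ)
    (h : Function.Injective lam) (hu : u + γ ≠ 0)
    (hU : sigma lam + u + f0 (sigma lam + u) ≠ 0) : IsUnit (twist γ f0 u lam) := by
  rw [← Matrix.vecMul_injective_iff_isUnit, ← Matrix.coe_vecMulLinear, ← LinearMap.ker_eq_bot,
    LinearMap.ker_eq_bot']
  intro r hr
  set U := sigma lam + u + f0 (sigma lam + u)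
  set p := sigma lam + u + γ with hp
  have h1 (j : Fin n) : ∑ i, r i / gauge U i * polyVec p (lam j) i = 0 := by
    have h2 := congrFun hr j
    simp only [Matrix.vecMulLinear_apply, Matrix.vecMul, dotProduct, twist_apply,
      Pi.zero_apply] at h2
    refine (mul_eq_zero.1 (?_ : _ * wt lam j = 0)).resolve_right (wt_ne_zero h j)
    rw [← h2, Finset.sum_mul]
    exact Finset.sum_congr rfl fun i _ => by ring
  have h2 (i : Fin n) (hi : (i : ℕ) + 1 = n) : r i / gauge U i = 0 := by
    have h3 : ∑ j, wt lam j * ∑ i, r i / gauge U i * polyVec p (lam j) i = 0 := by simp [h1]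
    simp_rw [Finset.mul_sum, mul_left_comm (wt lam _)] at h3
    rw [Finset.sum_comm] at h3
    simp_rw [← Finset.mul_sum, sum_wt_mul_polyVec h] at h3
    rw [Finset.sum_eq_single i, if_pos hi] at h3
    · refine (mul_eq_zero.1 h3).resolve_right ?_
      rwa [hp, add_assoc, add_sub_cancel_left]
    · intro k _ hk
      rw [if_neg, mul_zero]
      exact fun hk' => hk (Fin.ext (by omega))
    · simp
  have h3 : (fun i => r i / gauge U i) = 0 := by
    refine Matrix.eq_zero_of_mulVec_eq_zero (Matrix.det_vandermonde_ne_zero_iff.2 h) ?_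
    ext j
    simp only [Matrix.mulVec, dotProduct, Matrix.vandermonde_apply, Pi.zero_apply]
    rw [← h1 j]
    refine Finset.sum_congr rfl fun i _ => ?_
    by_cases hi : (i : ℕ) + 1 = n
    · rw [h2 i hi, mul_zero, zero_mul]
    · rw [polyVec, if_neg hi, mul_comm]
  ext i
  exact (div_eq_zero_iff.1 (congrFun h3 i)).resolve_right (gauge_ne_zero hU i)

/-! ### Entries of the structure matrices and of products -/

section entries

variable {n : ℕ} (a b p q : Fin n)

theorem e_apply (i j : Fin n) : e i j a p = (if i = a then 1 else 0) * if j = p then 1 else 0 := by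
  simp only [e, Matrix.single_apply, ite_and, ite_mul, one_mul, zero_mul]

theorem bMat_apply : bMat n (a, b) (p, q) =
    (if a = p then 1 else 0) * if a = q then 1 else 0 := by
  simp only [bMat, Matrix.sum_apply, Matrix.kroneckerMap_apply, e_apply]
  rw [Finset.sum_eq_single a (by simp +contextual) (by simp),
    Finset.sum_eq_single b (by simp +contextual) (by simp)]
  simp

theorem dMat_apply : dMat n (a, b) (p, q) =
    (if a = q then 1 else 0) * if b = p then 1 else 0 := by
  simp only [dMat, Matrix.sum_apply, Matrix.kroneckerMap_apply, e_apply]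
  rw [Finset.sum_eq_single a (by simp +contextual) (by simp),
    Finset.sum_eq_single b (by simp +contextual) (by simp)]
  simp only [if_true]
  ring

theorem one_apply_prod : (1 : Mat2 n) (a, b) (p, q) =
    (if a = p then 1 else 0) * if b = q then 1 else 0 := by
  simp only [Matrix.one_apply, Prod.mk.injEq, ite_and, ite_mul, one_mul, zero_mul]

theorem B_apply (γ v : ℂ) (lam : Fin n → ℂ) : B γ v lam (a, b) (p, q) =
    (if a = p then 1 else 0) * ((if b = q then 1 else 0) +
      y γ lam b p * ((if b = q then 1 else 0) - if p = q then 1 else 0) -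
      γ / (v + γ) * if p = q then 1 else 0) := by
  have h : Binf γ lam = 1 + ∑ i : Fin n, ∑ j : Fin n,
      y γ lam i j • (e j j ⊗ₖ (e i i - e i j)) := by
    rw [Binf]
    congr 1
    -- The term i = j contains e_ii - e_ii = 0, so the restriction i ≠ j can be dropped.
    exact Finset.sum_congr rfl fun i _ => Finset.sum_erase _ (by simp)
  simp only [B, h, Matrix.add_apply, Matrix.sub_apply, Matrix.smul_apply, smul_eq_mul,
    Matrix.sum_apply, Matrix.kroneckerMap_apply, e_apply, bMat_apply, one_apply_prod]
  rw [Finset.sum_eq_single b (by simp +contextual) (by simp),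
    Finset.sum_eq_single a (by simp +contextual) (by simp)]
  by_cases h1 : a = p
  · subst h1
    simp only [if_true]
    ring
  · simp [h1]

theorem A_apply (γ u v : ℂ) (lam : Fin n → ℂ) : A γ u v lam (a, b) (p, q) =
    (if a = p then 1 else 0) * (if b = q then 1 else 0) +
      x γ lam a b * (((if a = p then 1 else 0) - if b = p then 1 else 0) *
        ((if b = q then 1 else 0) - if a = q then 1 else 0)) +
      γ / (u - v) * ((if a = q then 1 else 0) * if b = p then 1 else 0) +
      γ / v * ((if a = p then 1 else 0) * if a = q then 1 else 0) -
      γ / (u + γ) * ((if b = q then 1 else 0) * if b = p then 1 else 0) := by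
  have h : Ainf γ lam = 1 + ∑ i : Fin n, ∑ j : Fin n,
      x γ lam i j • ((e i i - e i j) ⊗ₖ (e j j - e j i)) := by
    rw [Ainf]
    congr 1
    exact Finset.sum_congr rfl fun i _ => Finset.sum_erase _ (by simp)
  simp only [A, h, flip, Matrix.submatrix_apply, Prod.swap_prod_mk, Matrix.add_apply,
    Matrix.sub_apply, Matrix.smul_apply, smul_eq_mul, Matrix.sum_apply,
    Matrix.kroneckerMap_apply, e_apply, bMat_apply, dMat_apply, one_apply_prod]
  rw [Finset.sum_eq_single a (by simp +contextual) (by simp),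
    Finset.sum_eq_single b (by simp +contextual) (by simp)]
  simp only [if_true]
  ring

theorem D_apply (γ s : ℂ) (lam : Fin n → ℂ) : D γ s lam (a, b) (p, q) =
    (if a = p then 1 else 0) * (if b = q then 1 else 0) +
      x γ lam a b * ((if a = q then 1 else 0) * (if b = p then 1 else 0) -
        (if a = p then 1 else 0) * if b = q then 1 else 0) +
      γ / s * ((if a = q then 1 else 0) * if b = p then 1 else 0) := by
  have h : Dinf γ lam = 1 + ∑ i : Fin n, ∑ j : Fin n,
      x γ lam i j • (e i j ⊗ₖ e j i - e i i ⊗ₖ e j j) := by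
    rw [Dinf]
    congr 1
    exact Finset.sum_congr rfl fun i _ => Finset.sum_erase _ (by simp)
  simp only [D, h, Matrix.add_apply, Matrix.sub_apply, Matrix.smul_apply, smul_eq_mul,
    Matrix.sum_apply, Matrix.kroneckerMap_apply, e_apply, dMat_apply, one_apply_prod]
  rw [Finset.sum_eq_single a (by simp +contextual) (by simp),
    Finset.sum_eq_single b (by simp +contextual) (by simp)]
  simp only [if_true]
  ring

theorem mul_sp1_apply (S : Mat2 n) (M : Mat n) :
    (S * sp1 M) (a, b) (p, q) = ∑ c, S (a, b) (c, q) * M c p := by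
  simp [sp1, Matrix.mul_apply, Fintype.sum_prod_type, Matrix.one_apply]

theorem mul_sp2_apply (S : Mat2 n) (M : Mat n) :
    (S * sp2 M) (a, b) (p, q) = ∑ d, S (a, b) (p, d) * M d q := by
  simp [sp2, Matrix.mul_apply, Fintype.sum_prod_type, Matrix.one_apply]

theorem sp1_mul_apply (S : Mat2 n) (M : Mat n) :
    (sp1 M * S) (a, b) (p, q) = ∑ c, M a c * S (c, b) (p, q) := by
  simp [sp1, Matrix.mul_apply, Fintype.sum_prod_type, Matrix.one_apply]

theorem sp2_mul_apply (S : Mat2 n) (M : Mat n) :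
    (sp2 M * S) (a, b) (p, q) = ∑ d, M b d * S (a, d) (p, q) := by
  simp [sp2, Matrix.mul_apply, Fintype.sum_prod_type, Matrix.one_apply]

theorem dyn2h1_apply (γ : ℂ) (M : (Fin n → ℂ) → Mat n) (lam : Fin n → ℂ) :
    dyn2h1 γ M lam (a, b) (p, q) = if a = p then M (shift γ p lam) b q else 0 := by
  simp [dyn2h1, Matrix.sum_apply, Matrix.kroneckerMap_apply, e_apply, eq_comm]

theorem dyn1h2_apply (γ : ℂ) (M : (Fin n → ℂ) → Mat n) (lam : Fin n → ℂ) :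
    dyn1h2 γ M lam (a, b) (p, q) = if b = q then M (shift γ q lam) a p else 0 := by
  simp [dyn1h2, Matrix.sum_apply, Matrix.kroneckerMap_apply, e_apply, eq_comm]

theorem mul_dyn2h1_apply (S : Mat2 n) (γ : ℂ) (M : (Fin n → ℂ) → Mat n) (lam : Fin n → ℂ) :
    (S * dyn2h1 γ M lam) (a, b) (p, q) = ∑ d, S (a, b) (p, d) * M (shift γ p lam) d q := by
  simp [Matrix.mul_apply, Fintype.sum_prod_type, dyn2h1_apply]

theorem dyn1h2_mul_apply (S : Mat2 n) (γ : ℂ) (M : (Fin n → ℂ) → Mat n) (lam : Fin n → ℂ) :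
    (dyn1h2 γ M lam * S) (a, b) (p, q) = ∑ c, M (shift γ b lam) a c * S (c, b) (p, q) := by
  simp [Matrix.mul_apply, Fintype.sum_prod_type, dyn1h2_apply]

end entries

theorem dyn1h2_inv_mul {n : ℕ} (γ : ℂ) (M : (Fin n → ℂ) → Mat n) (lam : Fin n → ℂ)
    (h : ∀ j, IsUnit (M (shift γ j lam))) :
    dyn1h2 γ (fun mu => (M mu)⁻¹) lam * dyn1h2 γ M lam = 1 := by
  ext ⟨a, b⟩ ⟨p, q⟩
  rw [dyn1h2_mul_apply, one_apply_prod]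
  simp only [dyn1h2_apply]
  have h2 := congrFun₂ (Matrix.nonsing_inv_mul _ ((Matrix.isUnit_iff_isUnit_det _).1 (h b))) a p
  rw [Matrix.mul_apply, Matrix.one_apply] at h2
  by_cases h1 : b = q
  · subst h1
    simp [h2]
  · simp [h1]

theorem flip_mul {n : ℕ} (M N : Mat2 n) : flip (M * N) = flip M * flip N :=
  (Matrix.submatrix_mul_equiv M N Prod.swap (Equiv.prodComm _ _) Prod.swap).symm

theorem flip_sp2 {n : ℕ} (M : Mat n) : flip (sp2 M) = sp1 M := by
  ext ⟨a, b⟩ ⟨p, q⟩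
  simp [flip, sp1, sp2, mul_comm]

theorem flip_dyn2h1 {n : ℕ} (γ : ℂ) (M : (Fin n → ℂ) → Mat n) (lam : Fin n → ℂ) :
    flip (dyn2h1 γ M lam) = dyn1h2 γ M lam := by
  ext ⟨a, b⟩ ⟨p, q⟩
  simp [flip, dyn2h1_apply, dyn1h2_apply]

theorem sp1_inv_mul {n : ℕ} {M : Mat n} (h : IsUnit M) : sp1 M⁻¹ * sp1 M = 1 := by
  rw [sp1, sp1, ← Matrix.mul_kronecker_mul, Matrix.nonsing_inv_mul _
    ((Matrix.isUnit_iff_isUnit_det _).1 h), one_mul, Matrix.one_kronecker_one]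

theorem sp2_inv_mul {n : ℕ} {M : Mat n} (h : IsUnit M) : sp2 M⁻¹ * sp2 M = 1 := by
  rw [sp2, sp2, ← Matrix.mul_kronecker_mul, Matrix.nonsing_inv_mul _
    ((Matrix.isUnit_iff_isUnit_det _).1 h), one_mul, Matrix.one_kronecker_one]

/-! ### Dynamical shifts -/

section shift

variable {n : ℕ} (γ : ℂ) (lam : Fin n → ℂ)

theorem shift_self (j : Fin n) : shift γ j lam j = lam j + γ := by simp [shift]

theorem shift_of_ne {j k : Fin n} (h : k ≠ j) : shift γ j lam k = lam k := by simp [shift, h]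

theorem sigma_shift (j : Fin n) : sigma (shift γ j lam) = sigma lam + γ := by
  simp [sigma, shift, Finset.sum_add_distrib]

variable {γ lam}

theorem Generic.injective (h : Generic γ lam) : Function.Injective lam := fun i j hij => by
  by_contra hne
  exact (h i j hne).1 (sub_eq_zero.2 hij)

theorem Generic.injective_shift (h : Generic γ lam) (j : Fin n) :
    Function.Injective (shift γ j lam) := by
  have key (k : Fin n) (hk : k ≠ j) : lam k ≠ lam j + γ := fun h1 =>
    (h k j hk).2 (by rw [h1]; ring)
  intro k l hkl
  by_contra hne
  by_cases hk : k = j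
  · subst hk
    rw [shift_self, shift_of_ne _ _ (Ne.symm hne)] at hkl
    exact key l (Ne.symm hne) hkl.symm
  · by_cases hl : l = j
    · subst hl
      rw [shift_self, shift_of_ne _ _ hne] at hkl
      exact key k hne hkl
    · rw [shift_of_ne _ _ hk, shift_of_ne _ _ hl] at hkl
      exact hne (h.injective hkl)

theorem wt_shift_of_ne (h : Generic γ lam) {p q : Fin n} (hpq : p ≠ q) :
    wt (shift γ p lam) q = wt lam q * ((lam q - lam p) / (lam q - lam p - γ)) := by
  have h1 := (h q p hpq.symm).1
  have h2 := sub_ne_zero.2 (h q p hpq.symm).2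
  have hp : p ∈ Finset.univ.erase q := Finset.mem_erase.2 ⟨hpq, Finset.mem_univ p⟩
  rw [wt, wt, ← Finset.mul_prod_erase _ _ hp, ← Finset.mul_prod_erase _ _ hp,
    shift_self, shift_of_ne _ _ hpq.symm, Finset.prod_congr rfl fun a ha => by
      rw [shift_of_ne _ _ (Finset.ne_of_mem_erase ha)]]
  rw [show lam q - (lam p + γ) = lam q - lam p - γ by ring, mul_inv, mul_inv]
  field_simp

theorem wt_shift_self (hγ : γ ≠ 0) (p : Fin n) :
    wt (shift γ p lam) p = γ / ∏ a, (lam p + γ - lam a) := by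
  rw [wt, ← Finset.mul_prod_erase _ _ (Finset.mem_univ p), shift_self,
    Finset.prod_congr rfl fun a ha => by rw [shift_of_ne _ _ (Finset.ne_of_mem_erase ha)],
    add_sub_cancel_left, div_mul_eq_div_div, div_self hγ, one_div]

end shift

theorem gConj_twist_apply {n : ℕ} (γ : ℂ) (f0 : ℂ → ℂ) (u : ℂ) (lam : Fin n → ℂ) (i j : Fin n) :
    gConj γ 1 (twist γ f0) u lam i j = polyVec (sigma lam + u) (lam j) i * wt lam j /
      gauge (sigma lam + u - γ + f0 (sigma lam + u - γ)) i := by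
  rw [gConj, twist_apply, one_mul, show sigma lam + (u - γ) = sigma lam + u - γ by ring,
    sub_add_cancel]

/-- The dynamical shift raises σ by γ and g lowers u by γ, so σ + u is unchanged. The gauge is then
that of the unshifted twist, which lets f₀ be arbitrary in the formula for B. -/
theorem gConj_twist_shift_apply {n : ℕ} (γ : ℂ) (f0 : ℂ → ℂ) (u : ℂ) (lam : Fin n → ℂ)
    (k i j : Fin n) :
    gConj γ 1 (twist γ f0) u (shift γ k lam) i j =
      polyVec (sigma lam + u + γ) (shift γ k lam j) i * wt (shift γ k lam) j /
        gauge (sigma lam + u + f0 (sigma lam + u)) i := by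
  rw [gConj_twist_apply, sigma_shift, show sigma lam + γ + u = sigma lam + u + γ by ring,
    add_sub_cancel_right]

theorem isUnit_gConj_twist {n : ℕ} (γ : ℂ) (f0 : ℂ → ℂ) (u : ℂ) (lam : Fin n → ℂ)
    (h : Function.Injective lam) (hu : u ≠ 0)
    (hU : sigma lam + u - γ + f0 (sigma lam + u - γ) ≠ 0) :
    IsUnit (gConj γ 1 (twist γ f0) u lam) := by
  rw [gConj, one_mul]
  refine isUnit_twist γ f0 _ lam h (by rwa [sub_add_cancel]) ?_
  rwa [show sigma lam + (u - γ) = sigma lam + u - γ by ring]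

/-! ### Parametrization of `B` -/

theorem twist_mul_B {n : ℕ} {γ : ℂ} (hγ : γ ≠ 0) (f0 : ℂ → ℂ) (u : ℂ) (lam : Fin n → ℂ)
    (h : Generic γ lam) (hu : u + γ ≠ 0) :
    sp2 (twist γ f0 u lam) * B γ u lam = dyn2h1 γ (gConj γ 1 (twist γ f0) u) lam := by
  ext ⟨a, b⟩ ⟨p, q⟩
  rw [sp2_mul_apply, dyn2h1_apply]
  simp only [B_apply]
  by_cases hap : a = p
  swap
  · simp [hap]
  subst hap
  simp only [if_true, twist_apply, gConj_twist_shift_apply, one_mul]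
  generalize gauge (sigma lam + u + f0 (sigma lam + u)) b = g
  by_cases haq : a = q
  · subst haq
    rw [shift_self, wt_shift_self hγ]
    have hz (j : Fin n) : lam a + γ ≠ lam j := by
      intro hj
      by_cases hja : j = a
      · subst hja
        exact hγ (by simpa using hj)
      · exact (h j a hja).2 (by rw [← hj]; ring)
    have hN : ∏ j, (lam a + γ - lam j) ≠ 0 := Finset.prod_ne_zero_iff.2 fun j _ =>
      sub_ne_zero.2 (hz j)
    have h1 := prod_mul_sum_wt_mul_polyVec_div h.injective (sigma lam + u + γ) hz b
    have h2 := sum_wt_mul_polyVec h.injective (sigma lam + u + γ) b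
    -- With z = λ_a + γ, the identity and y-terms together equal γ/(z - λ_d) for every d: for d = a
    -- this is 1, for d ≠ a it is -y_da.
    have h3 (d : Fin n) : polyVec (sigma lam + u + γ) (lam d) b * wt lam d / g *
        ((if d = a then 1 else 0) +
          y γ lam d a * ((if d = a then 1 else 0) - if a = a then 1 else 0) -
          γ / (u + γ) * if a = a then 1 else 0) =
        (γ * (wt lam d * polyVec (sigma lam + u + γ) (lam d) b / (lam a + γ - lam d)) -
          γ / (u + γ) * (wt lam d * polyVec (sigma lam + u + γ) (lam d) b)) / g := by
      rw [if_pos rfl]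
      by_cases hd : d = a
      · subst hd
        rw [if_pos rfl, add_sub_cancel_left]
        field_simp
        ring
      · have h4 := sub_ne_zero.2 (hz d)
        have h5 := sub_ne_zero.2 (h d a hd).2
        rw [if_neg hd, y, show lam d - lam a - γ = -(lam a + γ - lam d) by ring]
        field_simp
        ring
    rw [Finset.sum_congr rfl fun d _ => h3 d, ← Finset.sum_div,
      Finset.sum_sub_distrib, ← Finset.mul_sum, ← Finset.mul_sum, h2,
      eq_div_of_mul_eq hN ((mul_comm _ _).trans h1)]
    -- In the last row the interpolation correction contributes γ and the b-term -γ/(u+γ) · (u+γ);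
    -- they cancel.
    congr 1
    split_ifs
    · field_simp
      ring
    · field_simp
      ring
  · have h1 := sub_ne_zero.2 (h q a (Ne.symm haq)).2
    rw [shift_of_ne _ _ (Ne.symm haq), wt_shift_of_ne h haq, Finset.sum_eq_single q]
    · rw [if_pos rfl, if_neg haq, y]
      field_simp
      ring
    · intro d _ hd
      rw [if_neg hd, if_neg haq]
      ring
    · simp

/-! ### Parametrization of `A` -/

theorem R_mul_polyVec {n : ℕ} (γ f0 u v : ℂ) (lam : Fin n → ℂ) (huv : u ≠ v)
    (hU : sigma lam + u + f0 ≠ 0) (hW : sigma lam + v - γ + f0 ≠ 0)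
    (hU' : sigma lam + u - γ + f0 ≠ 0) (hW' : sigma lam + v + f0 ≠ 0) (X Y : ℂ) (a b : Fin n) :
    ∑ c : Fin n, ∑ d : Fin n, R γ f0 u v lam (a, b) (c, d) *
      (polyVec (sigma lam + u) X c / gauge (sigma lam + u - γ + f0) c *
        (polyVec (sigma lam + v + γ) Y d / gauge (sigma lam + v + f0) d)) =
      (polyVec (sigma lam + u + γ) X a * polyVec (sigma lam + v) Y b +
        γ / (u - v) * (polyVec (sigma lam + u + γ) Y a * polyVec (sigma lam + v) X b) +
        γ * polyDiv (sigma lam + u + γ) (sigma lam + v) X Y a b) /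
        (gauge (sigma lam + u + f0) a * gauge (sigma lam + v - γ + f0) b) := by
  have huv' := sub_ne_zero.2 huv
  have h1 := gauge_ne_zero hU a
  have h2 := gauge_ne_zero hW b
  rw [← sum_Rpoly_mul γ (γ / (u - v)) _ _ (by field_simp; ring), Finset.sum_div]
  refine Finset.sum_congr rfl fun c _ => ?_
  rw [Finset.sum_div]
  refine Finset.sum_congr rfl fun d _ => ?_
  have h3 := gauge_ne_zero hU' c
  have h4 := gauge_ne_zero hW' d
  have h5 := R_apply γ f0 u v lam hU hW a b c d
  rw [add_sub_cancel_right, eq_div_iff (mul_ne_zero h1 h2)]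
  field_simp
  linear_combination polyVec (sigma lam + u) X c * polyVec (sigma lam + v + γ) Y d * h5

section sums

variable {n : ℕ} (M N : Fin n → ℂ) (p q : Fin n) (k : Fin n → Fin n → ℂ)

theorem sum_mul_sum_indicator :
    ∑ d, N d * ∑ c, M c * (((if c = p then 1 else 0) * if d = q then 1 else 0) * k c d) =
      k p q * (M p * N q) := by
  rw [Finset.sum_eq_single q (by simp +contextual) (by simp),
    Finset.sum_eq_single p (by simp +contextual) (by simp)]
  simp only [if_true]
  ring

theorem sum_mul_sum_indicator_left :
    ∑ d, N d * ∑ c, M c * (((if c = p then 1 else 0) * if c = q then 1 else 0) * k c d) =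
      if p = q then M p * ∑ d, k p d * N d else 0 := by
  rw [Finset.mul_sum]
  split_ifs with h
  · subst h
    refine Finset.sum_congr rfl fun d _ => ?_
    rw [Finset.sum_eq_single p (by simp +contextual) (by simp)]
    simp only [if_true]
    ring
  · refine Finset.sum_eq_zero fun d _ => ?_
    rw [Finset.sum_eq_single p (by simp +contextual) (by simp)]
    simp [h]

theorem sum_mul_sum_indicator_right :
    ∑ d, N d * ∑ c, M c * (((if d = p then 1 else 0) * if d = q then 1 else 0) * k c d) =
      if p = q then N p * ∑ c, k c p * M c else 0 := by
  rw [Finset.sum_eq_single p (by simp +contextual) (by simp)]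
  by_cases h : p = q
  · simp only [if_pos h, if_true]
    congr 1
    refine Finset.sum_congr rfl fun c _ => ?_
    ring
  · simp [h]

theorem sum_mul_sum_indicators (k₁ k₂ k₃ k₄ : Fin n → Fin n → ℂ) :
    ∑ d, N d * ∑ c, M c * (
      ((if c = p then 1 else 0) * if d = q then 1 else 0) * k₁ c d +
      ((if c = q then 1 else 0) * if d = p then 1 else 0) * k₂ c d +
      ((if c = p then 1 else 0) * if c = q then 1 else 0) * k₃ c d +
      ((if d = p then 1 else 0) * if d = q then 1 else 0) * k₄ c d) =
    k₁ p q * (M p * N q) + k₂ q p * (M q * N p) +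
      (if p = q then M p * ∑ d, k₃ p d * N d else 0) +
      if p = q then N p * ∑ c, k₄ c p * M c else 0 := by
  simp only [mul_add (M _), Finset.sum_add_distrib, mul_add (N _), sum_mul_sum_indicator,
    sum_mul_sum_indicator_left, sum_mul_sum_indicator_right]

end sums

/-- The entries of A are sorted by their Kronecker deltas. The two patterns that leave one row index
free survive only for p = q and yield the sums over all nodes. -/
theorem sp2_mul_sp1_mul_A_apply {n : ℕ} (γ u v : ℂ) (lam : Fin n → ℂ) (M N : Mat n)
    (a b p q : Fin n) :
    (sp2 N * (sp1 M * A γ u v lam)) (a, b) (p, q) =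
      (1 + x γ lam p q) * (M a p * N b q) + (γ / (u - v) + x γ lam q p) * (M a q * N b p) +
      (if p = q then M a p * ∑ d, (γ / v - x γ lam p d) * N b d else 0) +
      if p = q then N b p * ∑ c, (-(γ / (u + γ)) - x γ lam c p) * M a c else 0 := by
  have h (c d : Fin n) : A γ u v lam (c, d) (p, q) =
      ((if c = p then 1 else 0) * if d = q then 1 else 0) * (1 + x γ lam c d) +
      ((if c = q then 1 else 0) * if d = p then 1 else 0) * (γ / (u - v) + x γ lam c d) +
      ((if c = p then 1 else 0) * if c = q then 1 else 0) * (γ / v - x γ lam c d) +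
      ((if d = p then 1 else 0) * if d = q then 1 else 0) * (-(γ / (u + γ)) - x γ lam c d) := by
    rw [A_apply]
    ring
  rw [sp2_mul_apply]
  simp only [sp1_mul_apply, h]
  exact sum_mul_sum_indicators (M a) (N b) p q (fun c d => 1 + x γ lam c d)
    (fun c d => γ / (u - v) + x γ lam c d) (fun c d => γ / v - x γ lam c d)
    (fun c d => -(γ / (u + γ)) - x γ lam c d)

theorem R_mul_twist {n : ℕ} (γ f0 u v : ℂ) (lam : Fin n → ℂ)
    (h : Function.Injective lam) (huv : u ≠ v) (hu : u + γ ≠ 0) (hv : v ≠ 0)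
    (hU : sigma lam + u + f0 ≠ 0) (hW' : sigma lam + v + f0 ≠ 0)
    (hU' : sigma lam + u - γ + f0 ≠ 0) (hW : sigma lam + v - γ + f0 ≠ 0) :
    R γ f0 u v lam * sp1 (gConj γ 1 (twist γ fun _ => f0) u lam) *
        sp2 (twist γ (fun _ => f0) v lam) =
      sp2 (gConj γ 1 (twist γ fun _ => f0) v lam) *
        (sp1 (twist γ (fun _ => f0) u lam) * A γ u v lam) := by
  ext ⟨a, b⟩ ⟨p, q⟩
  rw [sp2_mul_sp1_mul_A_apply, mul_sp2_apply]
  simp only [mul_sp1_apply, twist_apply, gConj_twist_apply]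
  have h1 := R_mul_polyVec γ f0 u v lam huv hU hW hU' hW' (lam p) (lam q) a b
  trans wt lam p * wt lam q * ∑ c : Fin n, ∑ d : Fin n, R γ f0 u v lam (a, b) (c, d) *
      (polyVec (sigma lam + u) (lam p) c / gauge (sigma lam + u - γ + f0) c *
        (polyVec (sigma lam + v + γ) (lam q) d / gauge (sigma lam + v + f0) d))
  · rw [Finset.sum_comm, Finset.mul_sum]
    refine Finset.sum_congr rfl fun d _ => ?_
    rw [Finset.sum_mul, Finset.mul_sum]
    refine Finset.sum_congr rfl fun c _ => ?_
    ring
  rw [h1]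
  have hga := gauge_ne_zero hU a
  have hgb := gauge_ne_zero hW b
  generalize gauge (sigma lam + u + f0) a = ga at *
  generalize gauge (sigma lam + v - γ + f0) b = gb at *
  by_cases hpq : p = q
  · subst hpq
    rw [if_pos rfl, if_pos rfl]
    have h2 := sum_wt_mul_polyDiv h (sigma lam + u + γ) (sigma lam + v) (lam p) a b
    have h3 := sum_wt_mul_polyVec h (sigma lam + u + γ) a
    have h4 := sum_wt_mul_polyVec h (sigma lam + v) b
    -- Away from j = p each summand is a divided difference at (λ_p, λ_j). The missing term j = p is
    -- the confluent value produced by R.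
    have h5 : polyVec (sigma lam + u + γ) (lam p) a *
          ∑ j, x γ lam p j * (wt lam j * polyVec (sigma lam + v) (lam j) b) -
        polyVec (sigma lam + v) (lam p) b *
          ∑ j, x γ lam p j * (wt lam j * polyVec (sigma lam + u + γ) (lam j) a) =
        γ * (∑ j, wt lam j * polyDiv (sigma lam + u + γ) (sigma lam + v) (lam p) (lam j) a b -
          wt lam p * polyDiv (sigma lam + u + γ) (sigma lam + v) (lam p) (lam p) a b) := by
      rw [← Finset.add_sum_erase Finset.univ (fun j => wt lam j *
          polyDiv (sigma lam + u + γ) (sigma lam + v) (lam p) (lam j) a b) (Finset.mem_univ p),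
        add_sub_cancel_left, Finset.mul_sum, Finset.mul_sum, Finset.mul_sum,
        ← Finset.sum_sub_distrib, ← Finset.sum_erase (a := p) _ (by ring)]
      refine Finset.sum_congr rfl fun j hj => ?_
      have hj' := h.ne (Finset.ne_of_mem_erase hj).symm
      have hj'' := sub_ne_zero.2 hj'
      rw [polyDiv_eq _ _ hj', x]
      field_simp
    have h6 : ∑ d, (γ / v - x γ lam p d) *
        (polyVec (sigma lam + v) (lam d) b * wt lam d / gb) =
        (γ / v * ∑ d, wt lam d * polyVec (sigma lam + v) (lam d) b -
          ∑ j, x γ lam p j * (wt lam j * polyVec (sigma lam + v) (lam j) b)) / gb := by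
      rw [Finset.mul_sum, ← Finset.sum_sub_distrib, Finset.sum_div]
      exact Finset.sum_congr rfl fun d _ => by ring
    have h7 : ∑ c, (-(γ / (u + γ)) - x γ lam c p) *
        (polyVec (sigma lam + u + γ) (lam c) a * wt lam c / ga) =
        (-(γ / (u + γ)) * ∑ c, wt lam c * polyVec (sigma lam + u + γ) (lam c) a +
          ∑ j, x γ lam p j * (wt lam j * polyVec (sigma lam + u + γ) (lam j) a)) / ga := by
      rw [Finset.mul_sum, ← Finset.sum_add_distrib, Finset.sum_div]
      refine Finset.sum_congr rfl fun c _ => ?_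
      rw [x, x, ← neg_sub (lam p), div_neg]
      ring
    rw [h6, h7, h3, h4]
    rw [h2] at h5
    -- Division by zero returns 0, so the formal diagonal value of x contributes nothing.
    have h8 : x γ lam p p = 0 := by simp [x]
    rw [h8]
    generalize ∑ j, x γ lam p j * (wt lam j * polyVec (sigma lam + v) (lam j) b) = Z at *
    generalize ∑ j, x γ lam p j * (wt lam j * polyVec (sigma lam + u + γ) (lam j) a) = Z' at *
    have h9 : (if (a : ℕ) + 1 = n then sigma lam + u + γ - sigma lam else 0) =
        (u + γ) * if (a : ℕ) + 1 = n then 1 else 0 := by split_ifs <;> ring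
    have h10 : (if (b : ℕ) + 1 = n then sigma lam + v - sigma lam else 0) =
        v * if (b : ℕ) + 1 = n then 1 else 0 := by split_ifs <;> ring
    rw [h9, h10]
    have h11 : ∀ (P : Prop) [Decidable P] (t : ℂ), (if P then t else 0) =
        t * if P then 1 else 0 := by
      intro P _ t
      split_ifs <;> ring
    rw [h11 _ (polyVec _ _ a), h11 _ (polyVec _ _ b)] at h5
    have h12 (t : ℂ) : γ / (u + γ) * ((u + γ) * t) = γ * t := by field_simp
    have h13 (t : ℂ) : γ / v * (v * t) = γ * t := by field_simp
    rw [h13, neg_mul, h12]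
    linear_combination wt lam p / (ga * gb) * h5
  · have h2 := sub_ne_zero.2 (h.ne hpq)
    have h3 := sub_ne_zero.2 (h.ne (Ne.symm hpq))
    rw [if_neg hpq, if_neg hpq, polyDiv_eq _ _ (h.ne hpq), x, x,
      show lam q - lam p = -(lam p - lam q) by ring]
    field_simp
    ring

/-! ### Parametrization of `D` -/

theorem sp2_mul_dyn1h2_mul_D_apply {n : ℕ} (γ s : ℂ) (lam : Fin n → ℂ)
    (M : (Fin n → ℂ) → Mat n) (N : Mat n) (a b p q : Fin n) :
    (sp2 N * (dyn1h2 γ M lam * D γ s lam)) (a, b) (p, q) =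
      (1 - x γ lam p q) * (M (shift γ q lam) a p * N b q) +
        (γ / s + x γ lam q p) * (M (shift γ p lam) a q * N b p) := by
  have h (c d : Fin n) : D γ s lam (c, d) (p, q) =
      ((if c = p then 1 else 0) * if d = q then 1 else 0) * (1 - x γ lam c d) +
      ((if c = q then 1 else 0) * if d = p then 1 else 0) * (γ / s + x γ lam c d) := by
    rw [D_apply]
    ring
  rw [sp2_mul_apply]
  simp only [dyn1h2_mul_apply, h, mul_add (M _ _ _), Finset.sum_add_distrib, mul_add (N _ _)]
  congr 1
  · rw [Finset.sum_eq_single q (by simp +contextual) (by simp),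
      Finset.sum_eq_single p (by simp +contextual) (by simp)]
    simp only [if_true]
    ring
  · rw [Finset.sum_eq_single p (by simp +contextual) (by simp),
      Finset.sum_eq_single q (by simp +contextual) (by simp)]
    simp only [if_true]
    ring

theorem R_mul_twist_dyn {n : ℕ} {γ : ℂ} (hγ : γ ≠ 0) (f0 u v : ℂ) (lam : Fin n → ℂ)
    (h : Generic γ lam) (huv : u ≠ v)
    (hU : sigma lam + u + f0 ≠ 0) (hW' : sigma lam + v + f0 ≠ 0)
    (hU' : sigma lam + u - γ + f0 ≠ 0) (hW : sigma lam + v - γ + f0 ≠ 0) :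
    R γ f0 u v lam * sp1 (gConj γ 1 (twist γ fun _ => f0) u lam) *
        dyn2h1 γ (gConj γ 1 (twist γ fun _ => f0) v) lam =
      sp2 (gConj γ 1 (twist γ fun _ => f0) v lam) *
        (dyn1h2 γ (gConj γ 1 (twist γ fun _ => f0) u) lam * D γ (u - v) lam) := by
  ext ⟨a, b⟩ ⟨p, q⟩
  rw [sp2_mul_dyn1h2_mul_D_apply, mul_dyn2h1_apply]
  simp only [mul_sp1_apply, gConj_twist_shift_apply]
  simp only [gConj_twist_apply]
  have h1 := R_mul_polyVec γ f0 u v lam huv hU hW hU' hW' (lam p) (shift γ p lam q) a b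
  trans wt lam p * wt (shift γ p lam) q * ∑ c : Fin n, ∑ d : Fin n, R γ f0 u v lam (a, b) (c, d) *
      (polyVec (sigma lam + u) (lam p) c / gauge (sigma lam + u - γ + f0) c *
        (polyVec (sigma lam + v + γ) (shift γ p lam q) d / gauge (sigma lam + v + f0) d))
  · rw [Finset.sum_comm, Finset.mul_sum]
    refine Finset.sum_congr rfl fun d _ => ?_
    rw [Finset.sum_mul, Finset.mul_sum]
    refine Finset.sum_congr rfl fun c _ => ?_
    ring
  rw [h1]
  have hga := gauge_ne_zero hU a
  have hgb := gauge_ne_zero hW b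
  generalize gauge (sigma lam + u + f0) a = ga at *
  generalize gauge (sigma lam + v - γ + f0) b = gb at *
  have huv' := sub_ne_zero.2 huv
  by_cases hpq : p = q
  · subst hpq
    -- Here Y = X + γ, so 1 + γ/(X - Y) = 0 and only the exchange term survives, with coefficient s
    -- + 1; `x` at (p, p) is 0 by convention.
    rw [polyDiv_eq _ _ (by rw [shift_self]; simpa using hγ), shift_self, x, sub_self, div_zero,
      sub_add_cancel_left]
    field_simp
    ring
  · have h2 := (h p q hpq).1
    have h3 := sub_ne_zero.2 (h p q hpq).2
    have h4 := sub_ne_zero.2 (h q p (Ne.symm hpq)).2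
    rw [shift_of_ne _ _ (Ne.symm hpq), shift_of_ne _ _ hpq, wt_shift_of_ne h hpq,
      wt_shift_of_ne h (Ne.symm hpq), polyDiv_eq _ _ (h.injective.ne hpq), x, x]
    rw [← neg_sub (lam p) (lam q)] at h4 ⊢
    field_simp
    ring

/-! ### The dynamical variable -/

/-- For f₀ = γ the factors (σ+u+γ)/U and (σ+v)/(W-γ) become 1, so the two separate last-row sums are
exactly the term i = n of the triple sum in R⁰. -/
theorem R_eq_R0 {n : ℕ} (hn : 1 ≤ n) (γ u v : ℂ) (lam : Fin n → ℂ)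
    (hU : sigma lam + u + γ ≠ 0) (hW : sigma lam + v ≠ 0) :
    R γ γ u v lam = R0 n γ (u + sigma lam) (v + sigma lam) := by
  obtain ⟨m, rfl⟩ := Nat.exists_eq_add_of_le' hn
  simp only [R, R0, Nat.add_sub_cancel]
  generalize sigma lam = σ at *
  rw [show u + σ - (v + σ) = u - v by ring, show σ + u - γ + γ = u + σ by ring,
    show σ + v - γ + γ = v + σ by ring, show σ + u + γ = u + σ + γ by ring,
    show σ + v = v + σ by ring]
  have hU' : u + σ + γ ≠ 0 := by rwa [add_comm u]
  have hW' : v + σ ≠ 0 := by rwa [add_comm]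
  rw [div_self hU', div_self hW', mul_one, Finset.sum_Icc_succ_top (by omega), Nat.add_sub_cancel,
    mul_comm (v + σ + γ) (u + σ), mul_comm (u + σ + γ) (v + σ)]
  simp only [Finset.sum_sub_distrib]
  module

theorem R_shift {n : ℕ} (γ f0 u v : ℂ) (lam : Fin n → ℂ) (j : Fin n) :
    R γ f0 (u - γ) (v - γ) (shift γ j lam) = R γ f0 u v lam := by
  simp only [R, sigma_shift]
  generalize sigma lam = σ
  rw [show u - γ - (v - γ) = u - v by ring, show σ + γ + (u - γ) = σ + u by ring,
    show σ + γ + (v - γ) = σ + v by ring]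

/-! ### The deformed Yang–Baxter equation -/

theorem R0_apply {n : ℕ} (hn : 1 ≤ n) (γ u v : ℂ) (hu : u + γ ≠ 0) (hv : v ≠ 0) (a b c d : Fin n) :
    R0 n γ u v (a, b) (c, d) * (gauge (u + γ) a * gauge v b) =
      Rpoly n γ (γ / (u - v)) (u + γ) v (a, b) (c, d) * (gauge u c * gauge (v + γ) d) := by
  -- R⁰ is R at λ = 0 with f₀ = γ; the nodes need not be distinct here.
  have hσ : sigma (0 : Fin n → ℂ) = 0 := by simp [sigma]
  have h1 := R_eq_R0 hn γ u v 0 (by rwa [hσ, zero_add]) (by rwa [hσ, zero_add])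
  have h2 := R_apply γ γ u v (0 : Fin n → ℂ) (by rwa [hσ, zero_add])
    (by rwa [hσ, zero_add, sub_add_cancel]) a b c d
  simpa only [h1, hσ, zero_add, add_zero, sub_add_cancel] using h2

/-! ### Action of the three legs on products of polynomial vectors -/

section legs

variable {n : ℕ}

/-- The vector `x ⊗ y ⊗ z`. -/
def tens (x y z : Fin n → ℂ) : Fin n × Fin n × Fin n → ℂ := fun p => x p.1 * y p.2.1 * z p.2.2

theorem leg12_mulVec (M : Mat2 n) (x y z : Fin n → ℂ) (a b c : Fin n) :
    (leg12 M).mulVec (tens x y z) (a, b, c) =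
      (∑ i, ∑ j, M (a, b) (i, j) * (x i * y j)) * z c := by
  simp [Matrix.mulVec, dotProduct, leg12, tens, Fintype.sum_prod_type, Finset.sum_mul, mul_assoc]

theorem leg13_mulVec (M : Mat2 n) (x y z : Fin n → ℂ) (a b c : Fin n) :
    (leg13 M).mulVec (tens x y z) (a, b, c) =
      (∑ i, ∑ j, M (a, c) (i, j) * (x i * z j)) * y b := by
  simp only [Matrix.mulVec, dotProduct, leg13, tens, Fintype.sum_prod_type, Matrix.of_apply,
    Finset.sum_mul]
  refine Finset.sum_congr rfl fun i _ => ?_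
  rw [Finset.sum_eq_single b (fun j _ hj => by simp [Ne.symm hj]) (by simp)]
  refine Finset.sum_congr rfl fun j _ => ?_
  rw [if_pos rfl]
  ring

theorem leg23_mulVec (M : Mat2 n) (x y z : Fin n → ℂ) (a b c : Fin n) :
    (leg23 M).mulVec (tens x y z) (a, b, c) =
      (∑ i, ∑ j, M (b, c) (i, j) * (y i * z j)) * x a := by
  simp only [Matrix.mulVec, dotProduct, leg23, tens, Fintype.sum_prod_type, Matrix.of_apply,
    Finset.sum_mul]
  rw [Finset.sum_eq_single a (fun j _ hj => by simp [Ne.symm hj]) (by simp)]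
  refine Finset.sum_congr rfl fun i _ => Finset.sum_congr rfl fun j _ => ?_
  rw [if_pos rfl]
  ring

variable {γ s p q p' q' X Y : ℂ}

theorem leg12_Rpoly_mulVec (hs : s * (p - q - γ) = γ) (hp : p' = p - γ)
    (hq : q' = q + γ) (h : X - Y ≠ 0) (z : Fin n → ℂ) :
    (leg12 (Rpoly n γ s p q)).mulVec (tens (polyVec p' X) (polyVec q' Y) z) =
      (1 + γ / (X - Y)) • tens (polyVec p X) (polyVec q Y) z +
        (s - γ / (X - Y)) • tens (polyVec p Y) (polyVec q X) z := by
  ext ⟨a, b, c⟩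
  rw [leg12_mulVec, hp, hq, sum_Rpoly_mul_of_ne γ s p q hs (sub_ne_zero.1 h)]
  simp only [tens, Pi.add_apply, Pi.smul_apply, smul_eq_mul]
  ring

theorem leg13_Rpoly_mulVec (hs : s * (p - q - γ) = γ) (hp : p' = p - γ)
    (hq : q' = q + γ) (h : X - Y ≠ 0) (z : Fin n → ℂ) :
    (leg13 (Rpoly n γ s p q)).mulVec (tens (polyVec p' X) z (polyVec q' Y)) =
      (1 + γ / (X - Y)) • tens (polyVec p X) z (polyVec q Y) +
        (s - γ / (X - Y)) • tens (polyVec p Y) z (polyVec q X) := by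
  ext ⟨a, b, c⟩
  rw [leg13_mulVec, hp, hq, sum_Rpoly_mul_of_ne γ s p q hs (sub_ne_zero.1 h)]
  simp only [tens, Pi.add_apply, Pi.smul_apply, smul_eq_mul]
  ring

theorem leg23_Rpoly_mulVec (hs : s * (p - q - γ) = γ) (hp : p' = p - γ)
    (hq : q' = q + γ) (h : X - Y ≠ 0) (z : Fin n → ℂ) :
    (leg23 (Rpoly n γ s p q)).mulVec (tens z (polyVec p' X) (polyVec q' Y)) =
      (1 + γ / (X - Y)) • tens z (polyVec p X) (polyVec q Y) +
        (s - γ / (X - Y)) • tens z (polyVec p Y) (polyVec q X) := by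
  ext ⟨a, b, c⟩
  rw [leg23_mulVec, hp, hq, sum_Rpoly_mul_of_ne γ s p q hs (sub_ne_zero.1 h)]
  simp only [tens, Pi.add_apply, Pi.smul_apply, smul_eq_mul]
  ring

end legs

/-- The parameters start at (u-γ, v, w+γ). They pass through (u-γ, v+γ, w) and (u, v+γ, w-γ) on the
left, through (u, v-γ, w+γ) and (u+γ, v-γ, w) on the right, and both sides end at (u+γ, v, w-γ). -/
theorem Rpoly_yang_baxter_mulVec {n : ℕ} (γ u v w X Y Z : ℂ) (huv : u - v ≠ 0) (huw : u - w ≠ 0)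
    (hvw : v - w ≠ 0) (hXY : X - Y ≠ 0) (hXZ : X - Z ≠ 0) (hYZ : Y - Z ≠ 0) :
    (leg12 (Rpoly n γ (γ / (u - v)) (u + γ) v) * leg13 (Rpoly n γ (γ / (u - w)) u (w - γ)) *
      leg23 (Rpoly n γ (γ / (v - w)) (v + γ) w)).mulVec
        (tens (polyVec (u - γ) X) (polyVec v Y) (polyVec (w + γ) Z)) =
    (leg23 (Rpoly n γ (γ / (v - w)) v (w - γ)) * leg13 (Rpoly n γ (γ / (u - w)) (u + γ) w) *
      leg12 (Rpoly n γ (γ / (u - v)) u (v - γ))).mulVec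
        (tens (polyVec (u - γ) X) (polyVec v Y) (polyVec (w + γ) Z)) := by
  have hYX : Y - X ≠ 0 := by rwa [← neg_sub, neg_ne_zero]
  have hZX : Z - X ≠ 0 := by rwa [← neg_sub, neg_ne_zero]
  have hZY : Z - Y ≠ 0 := by rwa [← neg_sub, neg_ne_zero]
  have e12 : γ / (u - v) * (u + γ - v - γ) = γ := by field_simp; ring
  have e12' : γ / (u - v) * (u - (v - γ) - γ) = γ := by field_simp; ring
  have e13 : γ / (u - w) * (u + γ - w - γ) = γ := by field_simp; ring
  have e13' : γ / (u - w) * (u - (w - γ) - γ) = γ := by field_simp; ring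
  have e23 : γ / (v - w) * (v + γ - w - γ) = γ := by field_simp; ring
  have e23' : γ / (v - w) * (v - (w - γ) - γ) = γ := by field_simp; ring
  have a1 {t : ℂ} : t = t + γ - γ := by ring
  have a2 {t : ℂ} : t = t - γ + γ := by ring
  simp only [← Matrix.mulVec_mulVec]
  rw [leg23_Rpoly_mulVec e23 a1 rfl hYZ, leg12_Rpoly_mulVec e12' rfl a2 hXY]
  simp only [Matrix.mulVec_add, Matrix.mulVec_smul]
  rw [leg13_Rpoly_mulVec e13' rfl a2 hXZ, leg13_Rpoly_mulVec e13' rfl a2 hXY,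
    leg13_Rpoly_mulVec e13 a1 rfl hXZ, leg13_Rpoly_mulVec e13 a1 rfl hYZ]
  simp only [Matrix.mulVec_add, Matrix.mulVec_smul]
  rw [leg12_Rpoly_mulVec e12 a1 rfl hXY, leg12_Rpoly_mulVec e12 a1 rfl hZY,
    leg12_Rpoly_mulVec e12 a1 rfl hXZ, leg12_Rpoly_mulVec e12 a1 rfl hYZ,
    leg23_Rpoly_mulVec e23' rfl a2 hYZ, leg23_Rpoly_mulVec e23' rfl a2 hYX,
    leg23_Rpoly_mulVec e23' rfl a2 hXZ, leg23_Rpoly_mulVec e23' rfl a2 hXY]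
  -- Both sides are now combinations of the same tensors with X, Y, Z permuted, and the coefficients
  -- agree as rational functions.
  match_scalars <;> field_simp <;> ring

/-- A polynomial vanishing off a finite set is zero. Its coefficient in degree n isolates the last
component, and the remaining components are distinct monomials. -/
theorem forall_eq_zero_of_sum_polyVec {n : ℕ} (p : ℂ) (S : Finset ℂ) (r : Fin n → ℂ)
    (h : ∀ X ∉ S, ∑ i, r i * polyVec p X i = 0) : r = 0 := by
  set P : Polynomial ℂ := ∑ i : Fin n, Polynomial.C (r i) *
    (if (i : ℕ) + 1 = n then Polynomial.X ^ (i : ℕ) * (Polynomial.C p - Polynomial.X)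
      else Polynomial.X ^ (i : ℕ)) with hP
  have hP0 : P = 0 := by
    refine Polynomial.eq_zero_of_infinite_isRoot P (S.finite_toSet.infinite_compl.mono ?_)
    intro z hz
    rw [Set.mem_ofPred_eq, Polynomial.IsRoot, hP, Polynomial.eval_finsetSum, ← h z hz]
    refine Finset.sum_congr rfl fun i _ => ?_
    rw [polyVec, Polynomial.eval_mul, Polynomial.eval_C]
    split_ifs <;> simp
  have h1 (i : Fin n) (hi : (i : ℕ) + 1 = n) : r i = 0 := by
    have h2 : P.coeff n = 0 := by rw [hP0, Polynomial.coeff_zero]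
    rw [hP, Polynomial.finsetSum_coeff, Finset.sum_eq_single i] at h2
    · rw [if_pos hi, mul_sub, Polynomial.coeff_C_mul, Polynomial.coeff_sub,
        Polynomial.coeff_mul_C, ← pow_succ, hi, Polynomial.coeff_X_pow, if_neg (by omega),
        Polynomial.coeff_X_pow, if_pos rfl] at h2
      linear_combination -h2
    · intro j _ hj
      have hj' : (j : ℕ) + 1 ≠ n := fun h3 => hj (Fin.ext (by omega))
      rw [if_neg hj', Polynomial.coeff_C_mul, Polynomial.coeff_X_pow, if_neg (by omega), mul_zero]
    · simp
  ext j
  have h2 : P.coeff j = 0 := by rw [hP0, Polynomial.coeff_zero]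
  rw [hP, Polynomial.finsetSum_coeff, Finset.sum_eq_single j] at h2
  · by_cases hj : (j : ℕ) + 1 = n
    · exact h1 j hj
    · rwa [if_neg hj, Polynomial.coeff_C_mul, Polynomial.coeff_X_pow, if_pos rfl, mul_one] at h2
  · intro i _ hij
    by_cases hi : (i : ℕ) + 1 = n
    · rw [h1 i hi, Polynomial.C_0, zero_mul, Polynomial.coeff_zero]
    · rw [if_neg hi, Polynomial.coeff_C_mul, Polynomial.coeff_X_pow,
        if_neg fun h3 => hij (Fin.ext h3.symm), mul_zero]
  · simp

/-- One variable is removed at a time: Z is free, Y avoids Z, and X avoids Y and Z, so each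
exceptional set is finite. -/
theorem Mat3_ext {n : ℕ} (p q r : ℂ) (M N : Mat3 n)
    (h : ∀ X Y Z : ℂ, X - Y ≠ 0 → X - Z ≠ 0 → Y - Z ≠ 0 →
      M.mulVec (tens (polyVec p X) (polyVec q Y) (polyVec r Z)) =
        N.mulVec (tens (polyVec p X) (polyVec q Y) (polyVec r Z))) : M = N := by
  ext t ⟨i, j, k⟩
  have h1 (X Y Z : ℂ) (hXY : X - Y ≠ 0) (hXZ : X - Z ≠ 0) (hYZ : Y - Z ≠ 0) :
      ∑ i, (∑ j, (∑ k, (M t (i, j, k) - N t (i, j, k)) * polyVec r Z k) * polyVec q Y j) *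
        polyVec p X i = 0 := by
    have h2 := congrFun (h X Y Z hXY hXZ hYZ) t
    simp only [Matrix.mulVec, dotProduct, Fintype.sum_prod_type, tens] at h2
    rw [← sub_eq_zero] at h2
    rw [← h2]
    simp only [← Finset.sum_sub_distrib, Finset.sum_mul]
    refine Finset.sum_congr rfl fun i _ => Finset.sum_congr rfl fun j _ =>
      Finset.sum_congr rfl fun k _ => ?_
    ring
  rw [← sub_eq_zero]
  refine congrFun (forall_eq_zero_of_sum_polyVec (n := n) r ∅
    (fun k => M t (i, j, k) - N t (i, j, k)) fun Z _ => ?_) k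
  refine congrFun (forall_eq_zero_of_sum_polyVec q {Z}
    (fun j => ∑ k, (M t (i, j, k) - N t (i, j, k)) * polyVec r Z k) fun Y hY => ?_) j
  refine congrFun (forall_eq_zero_of_sum_polyVec p {Y, Z}
    (fun i => ∑ j, (∑ k, (M t (i, j, k) - N t (i, j, k)) * polyVec r Z k) * polyVec q Y j)
      fun X hX => ?_) i
  simp only [Finset.mem_singleton, Finset.mem_insert, not_or, ← sub_eq_zero (b := Z),
    ← sub_eq_zero (b := Y)] at hX hY
  exact h1 X Y Z hX.1 hX.2 hY

theorem Rpoly_yang_baxter {n : ℕ} (γ u v w : ℂ) (huv : u - v ≠ 0) (huw : u - w ≠ 0)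
    (hvw : v - w ≠ 0) :
    leg12 (Rpoly n γ (γ / (u - v)) (u + γ) v) * leg13 (Rpoly n γ (γ / (u - w)) u (w - γ)) *
      leg23 (Rpoly n γ (γ / (v - w)) (v + γ) w) =
    leg23 (Rpoly n γ (γ / (v - w)) v (w - γ)) * leg13 (Rpoly n γ (γ / (u - w)) (u + γ) w) *
      leg12 (Rpoly n γ (γ / (u - v)) u (v - γ)) :=
  Mat3_ext (u - γ) v (w + γ) _ _ fun X Y Z hXY hXZ hYZ =>
    Rpoly_yang_baxter_mulVec γ u v w X Y Z huv huw hvw hXY hXZ hYZ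

/-- The diagonal gauge transformation of `V ⊗ V ⊗ V`. -/
def gauge3 (n : ℕ) (p q r : ℂ) : Mat3 n :=
  Matrix.diagonal fun t => gauge p t.1 * gauge q t.2.1 * gauge r t.2.2

theorem isUnit_gauge3 {n : ℕ} {p q r : ℂ} (hp : p ≠ 0) (hq : q ≠ 0) (hr : r ≠ 0) :
    IsUnit (gauge3 n p q r) := by
  rw [gauge3, Matrix.isUnit_diagonal, Pi.isUnit_iff]
  exact fun t => isUnit_iff_ne_zero.2
    (mul_ne_zero (mul_ne_zero (gauge_ne_zero hp _) (gauge_ne_zero hq _)) (gauge_ne_zero hr _))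

/-! ### Transfer of the Yang–Baxter equation from `Rpoly` to R⁰ -/

section gauge

variable {n : ℕ}

theorem gauge3_mul_leg12_R0 (hn : 1 ≤ n) (γ u v r : ℂ) (hu : u + γ ≠ 0) (hv : v ≠ 0) :
    gauge3 n (u + γ) v r * leg12 (R0 n γ u v) =
    leg12 (Rpoly n γ (γ / (u - v)) (u + γ) v) * gauge3 n u (v + γ) r := by
  ext ⟨a, b, c⟩ ⟨a', b', c'⟩
  rw [gauge3, gauge3, Matrix.diagonal_mul, Matrix.mul_diagonal, leg12, leg12, Matrix.of_apply,
    Matrix.of_apply]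
  dsimp only
  split_ifs with h
  · rw [h]
    linear_combination gauge r c' * R0_apply hn γ u v hu hv a b a' b'
  · rw [mul_zero, zero_mul]

theorem gauge3_mul_leg13_R0 (hn : 1 ≤ n) (γ u v r : ℂ) (hu : u + γ ≠ 0) (hv : v ≠ 0) :
    gauge3 n (u + γ) r v * leg13 (R0 n γ u v) =
    leg13 (Rpoly n γ (γ / (u - v)) (u + γ) v) * gauge3 n u r (v + γ) := by
  ext ⟨a, b, c⟩ ⟨a', b', c'⟩
  rw [gauge3, gauge3, Matrix.diagonal_mul, Matrix.mul_diagonal, leg13, leg13, Matrix.of_apply,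
    Matrix.of_apply]
  dsimp only
  split_ifs with h
  · rw [h]
    linear_combination gauge r b' * R0_apply hn γ u v hu hv a c a' c'
  · rw [mul_zero, zero_mul]

theorem gauge3_mul_leg23_R0 (hn : 1 ≤ n) (γ u v r : ℂ) (hu : u + γ ≠ 0) (hv : v ≠ 0) :
    gauge3 n r (u + γ) v * leg23 (R0 n γ u v) =
    leg23 (Rpoly n γ (γ / (u - v)) (u + γ) v) * gauge3 n r u (v + γ) := by
  ext ⟨a, b, c⟩ ⟨a', b', c'⟩
  rw [gauge3, gauge3, Matrix.diagonal_mul, Matrix.mul_diagonal, leg23, leg23, Matrix.of_apply,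
    Matrix.of_apply]
  dsimp only
  split_ifs with h
  · rw [h]
    linear_combination gauge r a' * R0_apply hn γ u v hu hv b c b' c'
  · rw [mul_zero, zero_mul]

end gauge

/-- The gauges follow the same parameter path as the polynomial vectors, so they telescope: both
sides carry (u+γ, v, w-γ) on the left and (u-γ, v, w+γ) on the right. -/
theorem R0_yang_baxter {n : ℕ} (hn : 1 ≤ n) (γ u v w : ℂ) (huv : u - v ≠ 0) (huw : u - w ≠ 0)
    (hvw : v - w ≠ 0) (hu : u ≠ 0) (hu' : u + γ ≠ 0) (hv : v ≠ 0) (hv' : v + γ ≠ 0)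
    (hv'' : v - γ ≠ 0) (hw : w ≠ 0) (hw' : w - γ ≠ 0) :
    leg12 (R0 n γ u v) * leg13 (R0 n γ (u - γ) (w - γ)) * leg23 (R0 n γ v w) =
      leg23 (R0 n γ (v - γ) (w - γ)) * leg13 (R0 n γ u w) *
        leg12 (R0 n γ (u - γ) (v - γ)) := by
  have e12 := gauge3_mul_leg12_R0 hn γ u v (w - γ) hu' hv
  have e13 := gauge3_mul_leg13_R0 hn γ (u - γ) (w - γ) (v + γ) (by rwa [sub_add_cancel]) hw'
  have e23 := gauge3_mul_leg23_R0 hn γ v w (u - γ) hv' hw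
  have e12' := gauge3_mul_leg12_R0 hn γ (u - γ) (v - γ) (w + γ) (by rwa [sub_add_cancel]) hv''
  have e13' := gauge3_mul_leg13_R0 hn γ u w (v - γ) hu' hw
  have e23' := gauge3_mul_leg23_R0 hn γ (v - γ) (w - γ) (u + γ) (by rwa [sub_add_cancel]) hw'
  simp only [sub_add_cancel, sub_sub_sub_cancel_right] at e12 e13 e23 e12' e13' e23'
  refine (isUnit_gauge3 (n := n) hu' hv hw').mul_left_cancel ?_
  calc _ = gauge3 n (u + γ) v (w - γ) * leg12 (R0 n γ u v) *
        leg13 (R0 n γ (u - γ) (w - γ)) * leg23 (R0 n γ v w) := by simp only [mul_assoc]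
    _ = leg12 (Rpoly n γ (γ / (u - v)) (u + γ) v) * leg13 (Rpoly n γ (γ / (u - w)) u (w - γ)) *
      leg23 (Rpoly n γ (γ / (v - w)) (v + γ) w) * gauge3 n (u - γ) v (w + γ) := by
      rw [e12, mul_assoc (leg12 _), e13, ← mul_assoc, mul_assoc _ (gauge3 _ _ _ _), e23,
        ← mul_assoc]
    _ = gauge3 n (u + γ) v (w - γ) * leg23 (R0 n γ (v - γ) (w - γ)) * leg13 (R0 n γ u w) *
        leg12 (R0 n γ (u - γ) (v - γ)) := by
      rw [Rpoly_yang_baxter γ u v w huv huw hvw, e23',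
        mul_assoc (leg23 _) (gauge3 _ _ _ _), e13', ← mul_assoc,
        mul_assoc _ (gauge3 _ _ _ _), e12', ← mul_assoc]
    _ = _ := by simp only [mul_assoc]

/-- Along u = v + γ the (n,n),(n,n) entry is 2(v+γ)²/(v(v+2γ)), although u - v is constant. -/
theorem R0_not_difference {n : ℕ} (hn : 1 ≤ n) (γ : ℂ) (hγ : γ ≠ 0) :
    ¬ ∃ F : ℂ → Mat2 n, ∀ u v : ℂ, u ≠ v → u + γ ≠ 0 → v ≠ 0 → R0 n γ u v = F (u - v) := by
  rintro ⟨F, hF⟩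
  let l : Fin n := ⟨n - 1, by omega⟩
  have hl : (l : ℕ) + 1 = n := Nat.sub_add_cancel hn
  have key (v : ℂ) (hv : v ≠ 0) (hv' : v + γ + γ ≠ 0) :
      F γ (l, l) (l, l) * ((v + γ + γ) * v) = 2 * ((v + γ) * (v + γ)) := by
    have h1 := R0_apply hn γ (v + γ) v hv' hv l l l l
    rw [hF (v + γ) v (by simpa using hγ) hv' hv] at h1
    simpa [gauge, hl, Rpoly, div_self hγ, one_add_one_eq_two] using h1
  -- The points v = γ and v = 2γ give the distinct values 8/3 and 9/4.
  have h1 := key γ hγ (by rw [← two_mul, ← add_one_mul]; exact mul_ne_zero (by norm_num) hγ)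
  have h2 := key (2 * γ) (mul_ne_zero two_ne_zero hγ)
    (by rw [show 2 * γ + γ + γ = 4 * γ by ring]; exact mul_ne_zero (by norm_num) hγ)
  have h3 : γ ^ 2 = 0 := by linear_combination (3 / 10 : ℂ) * h2 - (4 / 5 : ℂ) * h1
  exact hγ (pow_eq_zero_iff two_ne_zero |>.1 h3)

end ACF

end

/-! ### Assembly of the claims -/

theorem mainTheorem3 (n : ℕ) (hn : 1 ≤ n) (γ : ℂ) (hγ : γ ≠ 0) :
    -- the twist is invertible
    (∀ (f0 : ℂ → ℂ) (u : ℂ) (lam : Fin n → ℂ), Function.Injective lam → u + γ ≠ 0 →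
      ACF.sigma lam + u + f0 (ACF.sigma lam + u) ≠ 0 →
      IsUnit (ACF.twist γ f0 u lam)) ∧
    -- parametrization of `B` and of `C₁₂ = B₂₁`
    (∀ (f0 : ℂ → ℂ) (u : ℂ) (lam : Fin n → ℂ), ACF.Generic γ lam → u + γ ≠ 0 →
      ACF.sigma lam + u + f0 (ACF.sigma lam + u) ≠ 0 →
      ACF.B γ u lam = ACF.sp2 (ACF.twist γ f0 u lam)⁻¹ *
        ACF.dyn2h1 γ (ACF.gConj γ 1 (ACF.twist γ f0) u) lam ∧
      ACF.C γ u lam = ACF.sp1 (ACF.twist γ f0 u lam)⁻¹ *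
        ACF.dyn1h2 γ (ACF.gConj γ 1 (ACF.twist γ f0) u) lam) ∧
    -- parametrization of `A`
    (∀ (f0 u v : ℂ) (lam : Fin n → ℂ), Function.Injective lam →
      u ≠ v → u + γ ≠ 0 → v ≠ 0 →
      ACF.sigma lam + u + f0 ≠ 0 → ACF.sigma lam + v + f0 ≠ 0 →
      ACF.sigma lam + u - γ + f0 ≠ 0 → ACF.sigma lam + v - γ + f0 ≠ 0 →
      ACF.A γ u v lam =
        ACF.sp1 (ACF.twist γ (fun _ => f0) u lam)⁻¹ *
        ACF.sp2 (ACF.gConj γ 1 (ACF.twist γ (fun _ => f0)) v lam)⁻¹ *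
        ACF.R γ f0 u v lam *
        ACF.sp1 (ACF.gConj γ 1 (ACF.twist γ (fun _ => f0)) u lam) *
        ACF.sp2 (ACF.twist γ (fun _ => f0) v lam)) ∧
    -- parametrization of `D`
    (∀ (f0 u v : ℂ) (lam : Fin n → ℂ), ACF.Generic γ lam →
      u ≠ v → u ≠ 0 → v ≠ 0 →
      ACF.sigma lam + u + f0 ≠ 0 → ACF.sigma lam + v + f0 ≠ 0 →
      ACF.sigma lam + u - γ + f0 ≠ 0 → ACF.sigma lam + v - γ + f0 ≠ 0 →
      ACF.D γ (u - v) lam =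
        ACF.dyn1h2 γ (fun mu => (ACF.gConj γ 1 (ACF.twist γ (fun _ => f0)) u mu)⁻¹) lam *
        ACF.sp2 (ACF.gConj γ 1 (ACF.twist γ (fun _ => f0)) v lam)⁻¹ *
        ACF.R γ f0 u v lam *
        ACF.sp1 (ACF.gConj γ 1 (ACF.twist γ (fun _ => f0)) u lam) *
        ACF.dyn2h1 γ (ACF.gConj γ 1 (ACF.twist γ (fun _ => f0)) v) lam) ∧
    -- `R` is quasi non-dynamical: `R₁₂ = R₁₂^{gg}(h₃)`
    (∀ (f0 u v : ℂ) (lam : Fin n → ℂ), u ≠ v →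
      ACF.sigma lam + u + f0 ≠ 0 → ACF.sigma lam + v - γ + f0 ≠ 0 →
      ACF.leg12 (ACF.R γ f0 u v lam) =
        ACF.dyn12h3 γ (ACF.gConj2 γ 1 (ACF.R γ f0) u v) lam) ∧
    -- for `f₀ = γ`: `R = exp(-(σ/γ)(log g₁ + log g₂)) R⁰ exp((σ/γ)(log g₁ + log g₂))`
    (∀ (u v : ℂ) (lam : Fin n → ℂ), u ≠ v →
      ACF.sigma lam + u + γ ≠ 0 → ACF.sigma lam + v ≠ 0 →
      ACF.R γ γ u v lam = ACF.gConj2 γ (-(ACF.sigma lam / γ)) (ACF.R0 n γ) u v) ∧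
    -- `R⁰` depends on `u` and `v` separately, not only through `u - v`
    (¬ ∃ F : ℂ → ACF.Mat2 n, ∀ u v : ℂ, u ≠ v → u + γ ≠ 0 → v ≠ 0 →
      ACF.R0 n γ u v = F (u - v)) ∧
    -- the `g`-deformed Yang-Baxter equation for `R⁰`
    (∀ u v w : ℂ, u ≠ v → u ≠ w → v ≠ w →
      u ≠ 0 → u + γ ≠ 0 → v ≠ 0 → v + γ ≠ 0 → v - γ ≠ 0 → w ≠ 0 → w - γ ≠ 0 →
      ACF.leg12 (ACF.R0 n γ u v) *
        ACF.leg13 (ACF.gConj2 γ 1 (ACF.R0 n γ) u w) *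
        ACF.leg23 (ACF.R0 n γ v w) =
      ACF.leg23 (ACF.gConj2 γ 1 (ACF.R0 n γ) v w) *
        ACF.leg13 (ACF.R0 n γ u w) *
        ACF.leg12 (ACF.gConj2 γ 1 (ACF.R0 n γ) u v)) := by
  refine ⟨fun f0 u lam h hu hU => ACF.isUnit_twist γ f0 u lam h hu hU, ?_, ?_, ?_, ?_, ?_,
    ACF.R0_not_difference hn γ hγ, ?_⟩
  · intro f0 u lam h hu hU
    have hb := ACF.isUnit_twist γ f0 u lam h.injective hu hU
    have hB : ACF.B γ u lam = ACF.sp2 (ACF.twist γ f0 u lam)⁻¹ *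
        ACF.dyn2h1 γ (ACF.gConj γ 1 (ACF.twist γ f0) u) lam := by
      rw [← ACF.twist_mul_B hγ f0 u lam h hu, ← mul_assoc, ACF.sp2_inv_mul hb, one_mul]
    refine ⟨hB, ?_⟩
    rw [ACF.C, hB, ACF.flip_mul, ACF.flip_sp2, ACF.flip_dyn2h1]
  · intro f0 u v lam h huv hu hv hU hW hU' hW'
    have hb := ACF.isUnit_twist γ (fun _ => f0) u lam h hu hU
    have hbg := ACF.isUnit_gConj_twist γ (fun _ => f0) v lam h hv hW'
    simp only [mul_assoc]
    rw [← mul_assoc (ACF.R γ f0 u v lam), ACF.R_mul_twist γ f0 u v lam h huv hu hv hU hW hU' hW',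
      ← mul_assoc (ACF.sp2 _), ACF.sp2_inv_mul hbg, one_mul, ← mul_assoc, ACF.sp1_inv_mul hb,
      one_mul]
  · intro f0 u v lam h huv hu hv hU hW hU' hW'
    have hbg := ACF.isUnit_gConj_twist γ (fun _ => f0) v lam h.injective hv hW'
    have hbs (j : Fin n) : IsUnit
        (ACF.gConj γ 1 (ACF.twist γ fun _ => f0) u (ACF.shift γ j lam)) := by
      refine ACF.isUnit_gConj_twist γ (fun _ => f0) u _ (h.injective_shift j) hu ?_
      -- The two shifts compensate, so the nonvanishing condition at the shifted point is U ≠ 0.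
      rw [ACF.sigma_shift]
      convert hU using 1
      ring
    simp only [mul_assoc]
    rw [← mul_assoc (ACF.R γ f0 u v lam), ACF.R_mul_twist_dyn hγ f0 u v lam h huv hU hW hU' hW',
      ← mul_assoc (ACF.sp2 _), ACF.sp2_inv_mul hbg, one_mul, ← mul_assoc,
      ACF.dyn1h2_inv_mul γ _ lam hbs, one_mul]
  · intro f0 u v lam _ _ _
    ext ⟨a, b, c⟩ ⟨a', b', c'⟩
    simp only [ACF.leg12, ACF.dyn12h3, ACF.gConj2, Matrix.of_apply, one_mul, ACF.R_shift]
  · intro u v lam _ hU hW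
    rw [ACF.R_eq_R0 hn γ u v lam hU hW, ACF.gConj2, neg_mul, div_mul_cancel₀ _ hγ, sub_neg_eq_add,
      sub_neg_eq_add]
  · intro u v w huv huw hvw hu hu' hv hv' hv'' hw hw'
    simpa only [ACF.gConj2, one_mul] using ACF.R0_yang_baxter hn γ u v w (sub_ne_zero.2 huv)
      (sub_ne_zero.2 huw) (sub_ne_zero.2 hvw) hu hu' hv hv' hv'' hw hw'
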